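/- Setting. Let $n\ge 3$ be odd. A strategy is a vector $\pi\in\mathbb R^n$ with $\pi\ge 0$ and $\sum_i\pi_i=1$; it is a Nash equilibrium of a skew-symmetric matrix $A\in\mathbb R^{n\times n}$ if $\pi^{\top}Ay\ge 0$ for every strategy $y$. $A$ is non-redundant if every Nash equilibrium of $A$ has only positive entries, and $\alpha$-redundant if no Nash equilibrium of $A$ has all its entries $\ge\alpha$. Call $A$ admissible if $A\in[-1,1]^{n\times n}$ is skew-symmetric, $\mathrm{rank}(A)=n-1$, and some $x$ satisfies $x^{\top}A=0$ and $\sum_i x_i\ne 0$. In every round a learner, who does not know $A$, receives for each pair $i<j$ a result $X_{ij}$ whose law is $1$-sub-Gaussian with mean $a_{ij}$ (that is, $\mathbb P[|X_{ij}-a_{ij}|\ge c]\le 2e^{-c^2/2}$ for all $c\ge 0$); for each pair the law is the same in all rounds, and all results are independent. A (possibly randomized) sequential algorithm decides after each number of rounds, from the results so far, whether to go on or to stop and conclude "non-redundant" or "$\alpha$-redundant"; $\tau$ is the number of rounds before it stops. It is $(\alpha,\delta)$-PAC if for every admissible $A$ and all such laws it stops with a true conclusion with probability at least $1-\delta$.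 For real $\kappa,s$ let $Q=Q(n,\kappa,s)$ be the skew-symmetric $n\times n$ matrix with, for $i<j$, $q_{1n}=-2\kappa+s$ and, for $(i,j)\neq(1,n)$, $q_{ij}=\kappa$ if $j-i\le\frac{n-1}{2}$ and $q_{ij}=-\kappa$ if $j-i\ge\frac{n+1}{2}$. Theorem. Let $n\ge 5$ be odd, $\alpha>0$ and $0<\delta<1$, and let an $(\alpha,\delta)$-PAC algorithm be given. Let $\kappa$ satisfy $\alpha\le\kappa$, $4\kappa+(n-4)\alpha\le 1$ and $4\kappa\ne(n-4)\alpha$ (for $0<\alpha\le\frac1n$, for instance, $\kappa=\alpha$ is possible). Then both matrices $Q(n,\kappa,\alpha)$ and $Q(n,\kappa,-\alpha)$ are admissible, and when the unknown matrix is either one of them, $X_{1n}\sim\mathcal N(q_{1n},1)$, and the other results have arbitrary $1$-sub-Gaussian laws with the required means (for instance, they are deterministic), the expected stopping time satisfies $$\mathbb E[\tau]\ \ge\ \frac{1}{2\alpha^2}\log\frac{5}{12\delta}.$$ -/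

import Mathlib

open MeasureTheory ProbabilityTheory

namespace DuelingBandit

/-! ### Symmetric zero-sum games -/

/-- `π` is a Nash equilibrium of the symmetric zero-sum game with pay-off matrix `A`: a mixed
strategy with `πᵀ A y ≥ 0` for every mixed strategy `y`. -/
def IsNash {n : ℕ} (A : Matrix (Fin n) (Fin n) ℝ) (π : Fin n → ℝ) : Prop :=
  π ∈ stdSimplex ℝ (Fin n) ∧
    ∀ y ∈ stdSimplex ℝ (Fin n), 0 ≤ π ⬝ᵥ A.mulVec y

/-- Every Nash equilibrium of `A` is completely mixed. -/
def NonRedundant {n : ℕ} (A : Matrix (Fin n) (Fin n) ℝ) : Prop :=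
  ∀ π, IsNash A π → ∀ i, 0 < π i

/-- No Nash equilibrium of `A` has all its probabilities at least `α`. -/
def AlphaRedundant {n : ℕ} (α : ℝ) (A : Matrix (Fin n) (Fin n) ℝ) : Prop :=
  ¬ ∃ π, IsNash A π ∧ ∀ i, α ≤ π i

/-- The pay-off matrices that may be presented to a learner. -/
structure Admissible {n : ℕ} (A : Matrix (Fin n) (Fin n) ℝ) : Prop where
  odd : Odd n
  three_le : 3 ≤ n
  skew : A.transpose = -A
  bounded : ∀ i j, A i j ∈ Set.Icc (-1 : ℝ) 1
  rank_eq : A.rank = n - 1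
  kernel : ∃ x : Fin n → ℝ, Matrix.vecMul x A = 0 ∧ ∑ i, x i ≠ 0

/-! ### Duels -/

/-- The pairs `{i, j}` of moves, listed with `i < j`. -/
abbrev Pair (n : ℕ) : Type := {p : Fin n × Fin n // p.1 < p.2}

/-- The results of one round: one real number for every pair. -/
abbrev Round (n : ℕ) : Type := Pair n → ℝ

/-- `μ` is a 1-sub-Gaussian distribution with mean `m`. -/
def IsSubGaussian (m : ℝ) (μ : Measure ℝ) : Prop :=
  Integrable (fun x : ℝ => x) μ ∧ ∫ x, x ∂μ = m ∧
    ∀ c : ℝ, 0 ≤ c → μ.real {x | c ≤ |x - m|} ≤ 2 * Real.exp (-c ^ 2 / 2)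

/-- The laws `ν` of the duels fit the pay-off matrix `A`. -/
def IsDuelModel {n : ℕ} (A : Matrix (Fin n) (Fin n) ℝ) (ν : Pair n → ProbabilityMeasure ℝ) :
    Prop :=
  ∀ p : Pair n, IsSubGaussian (A p.1.1 p.1.2) (ν p : Measure ℝ)

/-! ### Sequential algorithms -/

/-- What an algorithm does after a round. -/
inductive Verdict : Type
  | goOn
  | nonRedundant
  | redundant

instance : MeasurableSpace Verdict := ⊤

/-- A (possibly randomized) sequential algorithm: it draws a private seed in `Ω`, and after `t`
rounds decides, from the seed and the results of these `t` rounds, whether to go on or to stop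
with one of the two conclusions. (What `act` says after the first stop is never used.) -/
structure Algorithm (n : ℕ) (Ω : Type*) [MeasurableSpace Ω] where
  seedLaw : ProbabilityMeasure Ω
  act : (t : ℕ) → Ω × (Fin t → Round n) → Verdict
  measurable_act : ∀ t, Measurable (act t)

namespace Algorithm

variable {n : ℕ} {Ω : Type*} [MeasurableSpace Ω]

/-- The action after `t` rounds, on the seed `z.1` and the infinite sequence of rounds `z.2`. -/
def actAt (𝒜 : Algorithm n Ω) (t : ℕ) (z : Ω × (ℕ → Round n)) : Verdict :=
  𝒜.act t (z.1, fun i : Fin t => z.2 i)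

/-- The number of rounds before the algorithm stops (`⊤` if it never does). -/
noncomputable def stoppingTime (𝒜 : Algorithm n Ω) (z : Ω × (ℕ → Round n)) : ℕ∞ :=
  ⨅ (t : ℕ) (_ : 𝒜.actAt t z ≠ Verdict.goOn), (t : ℕ∞)

/-- The algorithm stops, and its conclusion is `v`. -/
def Concludes (𝒜 : Algorithm n Ω) (v : Verdict) (z : Ω × (ℕ → Round n)) : Prop :=
  v ≠ Verdict.goOn ∧ ∃ t, 𝒜.actAt t z = v ∧ ∀ s < t, 𝒜.actAt s z = Verdict.goOn

/-- The joint law of the seed and of the rounds when the duels have laws `ν`: all results, for all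
pairs and in all rounds, are independent of each other and of the seed. -/
noncomputable def law (𝒜 : Algorithm n Ω) (ν : Pair n → ProbabilityMeasure ℝ) :
    Measure (Ω × (ℕ → Round n)) :=
  (𝒜.seedLaw : Measure Ω).prod
    (Measure.infinitePi fun _ : ℕ => Measure.pi fun p : Pair n => (ν p : Measure ℝ))

/-- The expected number of rounds when the duels have laws `ν`. -/
noncomputable def expectedTime (𝒜 : Algorithm n Ω) (ν : Pair n → ProbabilityMeasure ℝ) :
    ENNReal :=
  ∫⁻ z, (𝒜.stoppingTime z : ENNReal) ∂(𝒜.law ν)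

/-- The algorithm stops, and its conclusion about `A` is true: `A` is non-redundant, respectively
`α`-redundant. -/
def Correct (𝒜 : Algorithm n Ω) (α : ℝ) (A : Matrix (Fin n) (Fin n) ℝ)
    (z : Ω × (ℕ → Round n)) : Prop :=
  (𝒜.Concludes Verdict.nonRedundant z ∧ NonRedundant A) ∨
    (𝒜.Concludes Verdict.redundant z ∧ AlphaRedundant α A)

/-- `(α, δ)`-PAC: whatever the admissible matrix and the sub-Gaussian laws of the duels, the
algorithm stops with a correct conclusion with probability at least `1 - δ`. -/
def IsPAC (𝒜 : Algorithm n Ω) (α δ : ℝ) : Prop :=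
  ∀ A : Matrix (Fin n) (Fin n) ℝ, Admissible A →
    ∀ ν : Pair n → ProbabilityMeasure ℝ, IsDuelModel A ν →
      1 - δ ≤ (𝒜.law ν).real {z | 𝒜.Correct α A z}

end Algorithm

/-! ### The hard pair -/

/-- Entries of `Q(n, κ, s)` above the diagonal (rows and columns numbered from `0`). -/
noncomputable def hardEntry (n : ℕ) (κ s : ℝ) (i j : ℕ) : ℝ :=
  if i = 0 ∧ j = n - 1 then -2 * κ + s
  else if j - i ≤ (n - 1) / 2 then κ
  else -κ

/-- The skew-symmetric matrix `Q(n, κ, s)`. -/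
noncomputable def hardMatrix (n : ℕ) (κ s : ℝ) : Matrix (Fin n) (Fin n) ℝ :=
  fun i j =>
    if i < j then hardEntry n κ s i j
    else if j < i then -hardEntry n κ s j i
    else 0

/-- The pair formed by the first and the last move. -/
def cornerPair (n : ℕ) (hn : 2 ≤ n) : Pair n :=
  ⟨(⟨0, by omega⟩, ⟨n - 1, by omega⟩), by
    rw [Fin.lt_def]
    change 0 < n - 1
    omega⟩

end DuelingBandit

open DuelingBandit

namespace DuelingBandit

/-! ### The hard matrices -/

/-! Write `n = 2m + 1`. The two matrices `Q(n, κ, ±α)` differ only in the corner entry, by `2α`, yet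
they force opposite conclusions.

The kernel of `Q(n, κ, s)` is a line, spanned by a vector with entries `κ` at both ends, `2κ - s` in
the middle and `s` elsewhere. For `s = α` this vector, divided by its sum `4κ + (n - 4)α ≤ 1`, is an
equilibrium with all entries at least `α`, so "`α`-redundant" is false
(`not_alphaRedundant_hardMatrix`). For `s = -α` the uniform strategy on all moves but `0` and `m +
1` is an equilibrium, so "non-redundant" is false (`not_nonRedundant_hardMatrix`). A PAC algorithm
must therefore reach opposite conclusions in two models that differ in the law of one duel.

With unit Gaussian corner laws, a round carries relative entropy `(2α)² / 2 = 2α²`. By Wald's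
identity the stopped log-likelihood ratio has mean `2α²` times the expected number of rounds, and
the variational bound for relative entropy makes this at least `kl(1 - δ, δ)`
(`mul_measure_stopsIn_le`, `ofReal_le_expectedTime`). Finally `kl(1 - δ, δ) ≥ log (5 / (12 δ))`
(`log_le_binary_kl`). -/

lemma hardMatrix_transpose (n : ℕ) (κ s : ℝ) :
    (hardMatrix n κ s).transpose = -hardMatrix n κ s := by
  ext i j
  simp only [Matrix.transpose_apply, Matrix.neg_apply, hardMatrix]
  rcases lt_trichotomy i j with h | h | h
  · simp [h, h.not_gt]
  · simp [h]
  · simp [h, h.not_gt]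

lemma hardMatrix_vecMul (n : ℕ) (κ s : ℝ) (x : Fin n → ℝ) :
    Matrix.vecMul x (hardMatrix n κ s) = -(hardMatrix n κ s).mulVec x := by
  rw [← Matrix.mulVec_transpose, hardMatrix_transpose, Matrix.neg_mulVec]

lemma hardMatrix_mem_Icc {n : ℕ} {κ s : ℝ} (h1 : |κ| ≤ 1) (h2 : |-2 * κ + s| ≤ 1) (i j : Fin n) :
    hardMatrix n κ s i j ∈ Set.Icc (-1 : ℝ) 1 := by
  rw [abs_le] at h1 h2
  have key : ∀ a b : ℕ, hardEntry n κ s a b ∈ Set.Icc (-1 : ℝ) 1 := by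
    intro a b
    unfold hardEntry
    split_ifs <;> constructor <;> linarith
  unfold hardMatrix
  split_ifs
  · exact key _ _
  · have := key j i
    constructor <;> linarith [this.1, this.2]
  · norm_num

/-- `hardMatrix`, with entries indexed by natural numbers. -/
noncomputable def hardNatEntry (n : ℕ) (κ s : ℝ) (i j : ℕ) : ℝ :=
  if i < j then hardEntry n κ s i j else if j < i then -hardEntry n κ s j i else 0

/-- Every row of `Q` is constant on a few intervals. For a vector given by the increments of `F`,
the row products telescope on each interval and leave only a few values of `F`. -/
lemma sum_Ico_mul_diff (b F : ℕ → ℝ) (c : ℝ) {u v : ℕ} (huv : u ≤ v)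
    (h : ∀ j, u ≤ j → j < v → b j = c) :
    ∑ j ∈ Finset.Ico u v, b j * (F (j + 1) - F j) = c * (F v - F u) := by
  rw [← Finset.sum_Ico_sub F huv, Finset.mul_sum]
  refine Finset.sum_congr rfl fun j hj => ?_
  rw [Finset.mem_Ico] at hj
  rw [h j hj.1 hj.2]

lemma hardMatrix_mulVec_eq_sum (n : ℕ) (κ s : ℝ) (F : ℕ → ℝ) (k : Fin n) :
    (hardMatrix n κ s).mulVec (fun j => F (j + 1) - F j) k =
      ∑ j ∈ Finset.Ico 0 n, hardNatEntry n κ s k j * (F (j + 1) - F j) := by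
  rw [← Finset.range_eq_Ico, ← Fin.sum_univ_eq_sum_range
    (fun j => hardNatEntry n κ s k j * (F (j + 1) - F j))]
  rfl

lemma hardMatrix_mulVec_first {m : ℕ} (hm : 2 ≤ m) (κ s : ℝ) (F : ℕ → ℝ) (k : Fin (2 * m + 1))
    (hk : (k : ℕ) = 0) :
    (hardMatrix (2 * m + 1) κ s).mulVec (fun j => F (j + 1) - F j) k =
      κ * (2 * F (m + 1) - F 1 - F (2 * m))
        + (-2 * κ + s) * (F (2 * m + 1) - F (2 * m)) := by
  rw [hardMatrix_mulVec_eq_sum, hk,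
    ← Finset.sum_Ico_consecutive _ (show 0 ≤ 1 by omega) (show 1 ≤ 2 * m + 1 by omega),
    ← Finset.sum_Ico_consecutive _ (show 1 ≤ m + 1 by omega) (show m + 1 ≤ 2 * m + 1 by omega),
    ← Finset.sum_Ico_consecutive _ (show m + 1 ≤ 2 * m by omega)
      (show 2 * m ≤ 2 * m + 1 by omega),
    sum_Ico_mul_diff _ F 0 (by omega), sum_Ico_mul_diff _ F κ (by omega),
    sum_Ico_mul_diff _ F (-κ) (by omega), sum_Ico_mul_diff _ F (-2 * κ + s) (by omega)]
  · ring
  all_goals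
    intro j h1 h2
    unfold hardNatEntry hardEntry
    split_ifs <;> first | rfl | omega

lemma hardMatrix_mulVec_last {m : ℕ} (hm : 2 ≤ m) (κ s : ℝ) (F : ℕ → ℝ) (k : Fin (2 * m + 1))
    (hk : (k : ℕ) = 2 * m) :
    (hardMatrix (2 * m + 1) κ s).mulVec (fun j => F (j + 1) - F j) k =
      κ * (2 * F m - F 1 - F (2 * m)) + (2 * κ - s) * (F 1 - F 0) := by
  rw [hardMatrix_mulVec_eq_sum, hk,
    ← Finset.sum_Ico_consecutive _ (show 0 ≤ 1 by omega) (show 1 ≤ 2 * m + 1 by omega),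
    ← Finset.sum_Ico_consecutive _ (show 1 ≤ m by omega) (show m ≤ 2 * m + 1 by omega),
    ← Finset.sum_Ico_consecutive _ (show m ≤ 2 * m by omega)
      (show 2 * m ≤ 2 * m + 1 by omega),
    sum_Ico_mul_diff _ F (-(-2 * κ + s)) (by omega), sum_Ico_mul_diff _ F (-(-κ)) (by omega),
    sum_Ico_mul_diff _ F (-κ) (by omega), sum_Ico_mul_diff _ F 0 (by omega)]
  · ring
  all_goals
    intro j h1 h2
    unfold hardNatEntry hardEntry
    split_ifs <;> first | rfl | omega

lemma hardMatrix_mulVec_low {m : ℕ} (κ s : ℝ) (F : ℕ → ℝ) (k : Fin (2 * m + 1))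
    (h1k : 1 ≤ (k : ℕ)) (hkm : (k : ℕ) ≤ m) (hk : (k : ℕ) < 2 * m) :
    (hardMatrix (2 * m + 1) κ s).mulVec (fun j => F (j + 1) - F j) k =
      κ * (2 * F (k + m + 1) - F (k + 1) - F k - F (2 * m + 1) + F 0) := by
  rw [hardMatrix_mulVec_eq_sum,
    ← Finset.sum_Ico_consecutive _ (show 0 ≤ (k : ℕ) by omega) (show (k : ℕ) ≤ 2 * m + 1 by omega),
    ← Finset.sum_Ico_consecutive _ (show (k : ℕ) ≤ k + 1 by omega)
      (show (k : ℕ) + 1 ≤ 2 * m + 1 by omega),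
    ← Finset.sum_Ico_consecutive _ (show (k : ℕ) + 1 ≤ k + m + 1 by omega)
      (show (k : ℕ) + m + 1 ≤ 2 * m + 1 by omega),
    sum_Ico_mul_diff _ F (-κ) (by omega), sum_Ico_mul_diff _ F 0 (by omega),
    sum_Ico_mul_diff _ F κ (by omega), sum_Ico_mul_diff _ F (-κ) (by omega)]
  · ring
  all_goals
    intro j h1 h2
    unfold hardNatEntry hardEntry
    split_ifs <;> first | rfl | omega

lemma hardMatrix_mulVec_high {m : ℕ} (κ s : ℝ) (F : ℕ → ℝ) (k : Fin (2 * m + 1))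
    (h1k : m ≤ (k : ℕ)) (h0k : 1 ≤ (k : ℕ)) (hk : (k : ℕ) < 2 * m) :
    (hardMatrix (2 * m + 1) κ s).mulVec (fun j => F (j + 1) - F j) k =
      κ * (F (2 * m + 1) - F (k + 1) - F k + 2 * F (k - m) - F 0) := by
  rw [hardMatrix_mulVec_eq_sum,
    ← Finset.sum_Ico_consecutive _ (show 0 ≤ (k : ℕ) - m by omega)
      (show (k : ℕ) - m ≤ 2 * m + 1 by omega),
    ← Finset.sum_Ico_consecutive _ (show (k : ℕ) - m ≤ k by omega)
      (show (k : ℕ) ≤ 2 * m + 1 by omega),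
    ← Finset.sum_Ico_consecutive _ (show (k : ℕ) ≤ k + 1 by omega)
      (show (k : ℕ) + 1 ≤ 2 * m + 1 by omega),
    sum_Ico_mul_diff _ F (-(-κ)) (by omega), sum_Ico_mul_diff _ F (-κ) (by omega),
    sum_Ico_mul_diff _ F 0 (by omega), sum_Ico_mul_diff _ F κ (by omega)]
  · ring
  all_goals
    intro j h1 h2
    unfold hardNatEntry hardEntry
    split_ifs <;> first | rfl | omega

/-- A vector in the kernel of `Q(n, κ, s)` is determined by its first entry. -/
lemma eq_zero_of_hardMatrix_mulVec_eq_zero {m : ℕ} (hm : 2 ≤ m) {κ s : ℝ} (hκ : κ ≠ 0)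
    {x : Fin (2 * m + 1) → ℝ} (hx : (hardMatrix (2 * m + 1) κ s).mulVec x = 0)
    (hx0 : x ⟨0, by omega⟩ = 0) : x = 0 := by
  let y : ℕ → ℝ := fun j => if h : j < 2 * m + 1 then x ⟨j, h⟩ else 0
  let F : ℕ → ℝ := fun k => ∑ j ∈ Finset.range k, y j
  have hFx : x = fun j : Fin (2 * m + 1) => F (j + 1) - F j := by
    ext j
    simp only [F, y, Finset.sum_range_succ, add_sub_cancel_left, j.2, dite_true, Fin.eta]
  have F0 : F 0 = 0 := by simp [F]
  have F1 : F 1 = 0 := by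
    simp only [F, y, Finset.sum_range_one]
    rw [dif_pos (by omega), hx0]
  rw [hFx] at hx
  have low : ∀ k, 1 ≤ k → k ≤ m → 2 * F (k + m + 1) = F (k + 1) + F k + F (2 * m + 1) := by
    intro k h1 h2
    have h := congrFun hx ⟨k, by omega⟩
    rw [hardMatrix_mulVec_low κ s F ⟨k, by omega⟩ h1 h2 (by simp only; omega)] at h
    have h' := (mul_eq_zero.1 h).resolve_left hκ
    simp only at h'
    linarith
  have high : ∀ k, k < m → F (k + m + 1) + F (k + m) = F (2 * m + 1) + 2 * F k := by
    intro k h1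
    have h := congrFun hx ⟨k + m, by omega⟩
    rw [hardMatrix_mulVec_high κ s F ⟨k + m, by omega⟩ (by simp only; omega)
      (by simp only; omega) (by simp only; omega)] at h
    have h' := (mul_eq_zero.1 h).resolve_left hκ
    simp only [Nat.add_sub_cancel] at h'
    linarith
  have first := congrFun hx ⟨0, by omega⟩
  rw [hardMatrix_mulVec_first hm κ s F _ rfl, Pi.zero_apply] at first
  -- Two consecutive `low` equations and one `high` equation eliminate the upper half of `F` and
  -- leave `F (k + 1) - 2 F k + F (k - 1) = 0`. So `F` is affine on `1, ..., m`, and `F 1 = 0`. The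
  -- induction carries two consecutive values; the alternative covers `k + 2 = m + 1`, outside this
  -- range.
  have aff : ∀ k, k + 1 ≤ m → F (k + 1) = k * F 2 ∧ F (k + 2) = (k + 1) * F 2 ∨ k + 1 = m := by
    intro k
    induction k with
    | zero => intro _; left; constructor <;> simp [F1]
    | succ k ih =>
      intro hk
      rcases ih (by omega) with ⟨h1, h2⟩ | h
      · by_cases hkm : k + 2 = m
        · right; omega
        left
        refine ⟨by push_cast; exact h2, ?_⟩
        have e1 := low (k + 1) (by omega) (by omega)
        have e2 := low (k + 2) (by omega) (by omega)
        have e3 := high (k + 2) (by omega)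
        rw [show k + 2 + m = k + 1 + m + 1 by ring] at e3 e2
        push_cast
        rw [show k + 1 + 2 = k + 2 + 1 by ring]
        rw [show k + 1 + 1 = k + 2 by ring] at e1
        linarith
      · omega
  have aff' : ∀ k, k + 1 ≤ m → F (k + 1) = k * F 2 := by
    intro k hk
    by_cases h : k + 1 = m
    · obtain ⟨l, rfl⟩ : ∃ l, k = l + 1 := ⟨k - 1, by omega⟩
      rcases aff l (by omega) with h' | h'
      · rw [h'.2]; push_cast; rfl
      · omega
    · rcases aff k hk with h' | h'
      · exact h'.1
      · omega
  obtain ⟨l, rfl⟩ : ∃ l, m = l + 2 := ⟨m - 2, by omega⟩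
  have a1 := aff' (l + 1) (by omega)
  have a2 := aff' l (by omega)
  have e0 := high 0 (by omega)
  have e1 := high 1 (by omega)
  have e2 := low 1 (by omega) (by omega)
  have e3 := low (l + 1) (by omega) (by omega)
  have e4 := low (l + 2) (by omega) (by omega)
  simp only [Nat.reduceAdd, show l + 1 + 1 = l + 2 by ring, 
    show 0 + (l + 2) = l + 2 by ring, show 1 + (l + 2) = l + 3 by ring, show l + 1 + (l + 2) +
      1 = 2 * l + 4 by ring,
    show l + 2 + (l + 2) + 1 = 2 * l + 5 by ring,
    show 2 * (l + 2) = 2 * l + 4 by ring, show l + 2 + 1 = l + 3 by ring]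
    at a1 a2 e0 e1 e2 e3 e4 first
  push_cast at a1 a2
  -- The other rows already make the last entry of `x` vanish, so the corner entry, and with it `s`,
  -- drops out of row `0`. What remains of that row is `-F 2 = 0`.
  have hb : F 2 = 0 := by
    have hT : F (2 * l + 5) = (2 * l + 1) * F 2 := by linarith
    have hc : F (2 * l + 5) - F (2 * l + 4) = 0 := by linarith
    rw [hc] at first
    have : 2 * F (l + 3) - F 1 - F (2 * l + 4) = 0 := by
      refine (mul_eq_zero.1 (?_ : κ * _ = 0)).resolve_left hκ
      linarith
    linarith
  have hlow : ∀ k, k ≤ l + 2 → F k = 0 := by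
    intro k hk
    rcases k with _ | k
    · exact F0
    · rw [aff' k hk, hb, mul_zero]
  have hT : F (2 * l + 5) = 0 := by
    have := hlow (l + 2) le_rfl
    rw [hb] at a1 a2
    linarith
  have hmid : F (l + 3) = 0 := by
    have := hlow (l + 2) le_rfl
    linarith
  have hall : ∀ k, k ≤ 2 * l + 5 → F k = 0 := by
    intro k hk
    by_cases h1 : k ≤ l + 2
    · exact hlow k h1
    by_cases h2 : k = l + 3
    · rw [h2, hmid]
    obtain ⟨j, rfl⟩ : ∃ j, k = j + (l + 2) + 1 := ⟨k - l - 3, by omega⟩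
    have h := low j (by omega) (by omega)
    rw [show 2 * (l + 2) + 1 = 2 * l + 5 by ring, hT, hlow j (by omega)] at h
    have h' : F (j + 1) = 0 := by
      by_cases h3 : j + 1 ≤ l + 2
      · exact hlow _ h3
      · rw [show j + 1 = l + 3 by omega, hmid]
    linarith
  rw [hFx]
  ext j
  have hj := j.2
  simp only [Pi.zero_apply]
  rw [hall _ (by omega), hall _ (by omega), sub_zero]

/-- Partial sums of a kernel vector of `Q(2m + 1, κ, s)`, which has the entries `κ` at both ends,
`2κ - s` in the middle, and `s` elsewhere. -/
noncomputable def kernelSum (m : ℕ) (κ s : ℝ) (k : ℕ) : ℝ :=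
  if k = 0 then 0
  else if k ≤ m then κ + (k - 1) * s
  else if k ≤ 2 * m then 3 * κ + (k - 3) * s
  else 4 * κ + (2 * m - 3) * s

/-- The kernel vector of `Q(2m + 1, κ, s)` with partial sums `kernelSum m κ s`. -/
noncomputable def kernelVec (m : ℕ) (κ s : ℝ) (j : Fin (2 * m + 1)) : ℝ :=
  kernelSum m κ s (j + 1) - kernelSum m κ s j

lemma kernelSum_zero (m : ℕ) (κ s : ℝ) : kernelSum m κ s 0 = 0 := if_pos rfl

lemma kernelSum_low {m : ℕ} (κ s : ℝ) {k : ℕ} (h0 : 1 ≤ k) (h1 : k ≤ m) :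
    kernelSum m κ s k = κ + (k - 1) * s := by
  rw [kernelSum, if_neg (by omega), if_pos h1]

lemma kernelSum_mid {m : ℕ} (κ s : ℝ) {k : ℕ} (h0 : m < k) (h1 : k ≤ 2 * m) :
    kernelSum m κ s k = 3 * κ + (k - 3) * s := by
  rw [kernelSum, if_neg (by omega), if_neg (by omega), if_pos h1]

lemma kernelSum_last (m : ℕ) (κ s : ℝ) :
    kernelSum m κ s (2 * m + 1) = 4 * κ + (2 * m - 3) * s := by
  rw [kernelSum, if_neg (by omega), if_neg (by omega), if_neg (by omega)]

lemma sum_kernelVec (m : ℕ) (κ s : ℝ) :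
    ∑ i, kernelVec m κ s i = 4 * κ + (2 * m - 3) * s := by
  have h := Fin.sum_univ_eq_sum_range
    (fun j => kernelSum m κ s (j + 1) - kernelSum m κ s j) (2 * m + 1)
  rw [Finset.sum_range_sub, kernelSum_zero, kernelSum_last, sub_zero] at h
  exact h

lemma hardMatrix_mulVec_kernelVec {m : ℕ} (hm : 2 ≤ m) (κ s : ℝ) :
    (hardMatrix (2 * m + 1) κ s).mulVec (kernelVec m κ s) = 0 := by
  ext k
  have hk2 := k.2
  unfold kernelVec
  rw [Pi.zero_apply]
  by_cases h0 : (k : ℕ) = 0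
  · rw [hardMatrix_mulVec_first hm _ _ _ _ h0, kernelSum_mid _ _ (by omega) (by omega),
      kernelSum_low _ _ le_rfl (by omega), kernelSum_mid _ _ (by omega) (by omega),
      kernelSum_last]
    push_cast
    ring
  by_cases h1 : (k : ℕ) = 2 * m
  · rw [hardMatrix_mulVec_last hm _ _ _ _ h1, kernelSum_low _ _ (by omega) (by omega),
      kernelSum_low _ _ le_rfl (by omega), kernelSum_mid _ _ (by omega) (by omega),
      kernelSum_zero]
    push_cast
    ring
  by_cases h2 : (k : ℕ) < m
  · rw [hardMatrix_mulVec_low _ _ _ _ (by omega) (by omega) (by omega),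
      kernelSum_mid _ _ (by omega) (by omega), kernelSum_low _ _ (by omega) (by omega),
      kernelSum_low _ _ (by omega) (by omega), kernelSum_zero, kernelSum_last]
    push_cast
    ring
  -- Row `m` is separate because `k + m + 1` is then `n`, past the range of `kernelSum_mid`.
  by_cases h3 : (k : ℕ) = m
  · rw [hardMatrix_mulVec_low _ _ _ _ (by omega) (by omega) (by omega), h3,
      show m + m + 1 = 2 * m + 1 by ring, kernelSum_last, kernelSum_zero,
      kernelSum_mid _ _ (by omega) (by omega), kernelSum_low _ _ (by omega) (by omega)]
    push_cast
    ring
  · rw [hardMatrix_mulVec_high _ _ _ _ (by omega) (by omega) (by omega),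
      kernelSum_last, kernelSum_zero, kernelSum_mid _ _ (by omega) (by omega),
      kernelSum_mid _ _ (by omega) (by omega), kernelSum_low _ _ (by omega) (by omega),
      Nat.cast_sub (by omega)]
    push_cast
    ring

lemma le_kernelVec {m : ℕ} {κ s : ℝ} (h : s ≤ κ) (j : Fin (2 * m + 1)) (hm : 2 ≤ m) :
    s ≤ kernelVec m κ s j := by
  have hj := j.2
  unfold kernelVec
  by_cases h0 : (j : ℕ) = 0
  · rw [h0, kernelSum_zero, kernelSum_low _ _ le_rfl (by omega)]
    simpa using h
  by_cases h1 : (j : ℕ) = 2 * m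
  · rw [h1, kernelSum_last, kernelSum_mid _ _ (by omega) (by omega)]
    push_cast
    linarith
  by_cases h2 : (j : ℕ) < m
  · rw [kernelSum_low _ _ (by omega) (by omega), kernelSum_low _ _ (by omega) (by omega)]
    push_cast
    linarith
  by_cases h3 : (j : ℕ) = m
  · rw [h3, kernelSum_mid _ _ (by omega) (by omega), kernelSum_low _ _ (by omega) (by omega)]
    push_cast
    linarith
  · rw [kernelSum_mid _ _ (by omega) (by omega), kernelSum_mid _ _ (by omega) (by omega)]
    push_cast
    linarith

lemma rank_hardMatrix {m : ℕ} (hm : 2 ≤ m) {κ s : ℝ} (hκ : κ ≠ 0) :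
    (hardMatrix (2 * m + 1) κ s).rank = 2 * m + 1 - 1 := by
  let f := (hardMatrix (2 * m + 1) κ s).mulVecLin
  have hrank : (hardMatrix (2 * m + 1) κ s).rank + Module.finrank ℝ (LinearMap.ker f)
      = 2 * m + 1 := by
    have h := LinearMap.finrank_range_add_finrank_ker f
    rw [Module.finrank_fin_fun] at h
    exact h
  have hle : Module.finrank ℝ (LinearMap.ker f) ≤ 1 := by
    let g : LinearMap.ker f →ₗ[ℝ] ℝ :=
      (LinearMap.proj (⟨0, by omega⟩ : Fin (2 * m + 1))).comp (LinearMap.ker f).subtype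
    have hg : Function.Injective g := by
      rw [← LinearMap.ker_eq_bot, LinearMap.ker_eq_bot']
      rintro ⟨x, hx⟩ hx0
      exact Subtype.ext (eq_zero_of_hardMatrix_mulVec_eq_zero hm hκ hx hx0)
    simpa using LinearMap.finrank_le_finrank_of_injective hg
  have hpos : 0 < Module.finrank ℝ (LinearMap.ker f) := by
    rw [Module.finrank_pos_iff_exists_ne_zero]
    refine ⟨⟨kernelVec m κ s, hardMatrix_mulVec_kernelVec hm κ s⟩, fun h => hκ ?_⟩
    have h' := congrFun (congrArg Subtype.val h) ⟨0, by omega⟩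
    simpa [kernelVec, kernelSum_zero, kernelSum_low κ s le_rfl (show 1 ≤ m by omega)] using h'
  omega

lemma admissible_hardMatrix {m : ℕ} (hm : 2 ≤ m) {κ s : ℝ} (hκ : 0 < κ) (h1 : κ ≤ 1)
    (h2 : |-2 * κ + s| ≤ 1) (hsum : 4 * κ + (2 * m - 3) * s ≠ 0) :
    Admissible (hardMatrix (2 * m + 1) κ s) where
  odd := ⟨m, rfl⟩
  three_le := by omega
  skew := hardMatrix_transpose _ _ _
  bounded := hardMatrix_mem_Icc (by rwa [abs_of_pos hκ]) h2
  rank_eq := rank_hardMatrix hm hκ.ne'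
  kernel := by
    refine ⟨kernelVec m κ s, ?_, by rwa [sum_kernelVec]⟩
    rw [hardMatrix_vecMul, hardMatrix_mulVec_kernelVec hm, neg_zero]

/-! ### Equilibria of the hard matrices -/

lemma isNash_inv_sum_smul {n : ℕ} {A : Matrix (Fin n) (Fin n) ℝ} {x : Fin n → ℝ}
    (h0 : ∀ i, 0 ≤ x i) (hsum : 0 < ∑ i, x i) (hA : ∀ j, 0 ≤ Matrix.vecMul x A j) :
    IsNash A ((∑ i, x i)⁻¹ • x) := by
  refine ⟨⟨fun i => mul_nonneg (inv_nonneg.2 hsum.le) (h0 i), ?_⟩, fun y hy => ?_⟩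
  · simp only [Pi.smul_apply, smul_eq_mul]
    rw [← Finset.mul_sum, inv_mul_cancel₀ hsum.ne']
  · rw [smul_dotProduct, Matrix.dotProduct_mulVec]
    exact mul_nonneg (inv_nonneg.2 hsum.le)
      (Finset.sum_nonneg fun j _ => mul_nonneg (hA j) (hy.1 j))

lemma not_alphaRedundant_hardMatrix {m : ℕ} (hm : 2 ≤ m) {κ α : ℝ} (hα : 0 < α) (hακ : α ≤ κ)
    (hsum : 4 * κ + (2 * m - 3) * α ≤ 1) :
    ¬ AlphaRedundant α (hardMatrix (2 * m + 1) κ α) := by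
  have hm' : (2 : ℝ) ≤ m := by exact_mod_cast hm
  have hpos : 0 < 4 * κ + (2 * m - 3) * α := by
    have : 0 < (2 * m - 3) * α := mul_pos (by linarith) hα
    linarith
  refine not_not.2 ⟨_, isNash_inv_sum_smul (x := kernelVec m κ α)
    (fun i => hα.le.trans (le_kernelVec hακ i hm)) (by rwa [sum_kernelVec]) fun j => ?_,
    fun i => ?_⟩
  · rw [hardMatrix_vecMul, hardMatrix_mulVec_kernelVec hm, neg_zero, Pi.zero_apply]
  · rw [sum_kernelVec, Pi.smul_apply, smul_eq_mul]
    -- The sum of the kernel vector is at most `1`, so normalizing does not decrease its entries.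
    calc α ≤ kernelVec m κ α i := le_kernelVec hακ i hm
      _ ≤ _ := le_mul_of_one_le_left (hα.le.trans (le_kernelVec hακ i hm))
        ((one_le_inv₀ hpos).2 hsum)

/-- Partial sums of the indicator of the complement of `{0, m + 1}`. -/
noncomputable def gapSum (m k : ℕ) : ℝ :=
  if k = 0 then 0 else if k ≤ m + 1 then k - 1 else k - 2

lemma gapSum_low {m k : ℕ} (h0 : 1 ≤ k) (h1 : k ≤ m + 1) : gapSum m k = k - 1 := by
  rw [gapSum, if_neg (by omega), if_pos h1]

lemma gapSum_high {m k : ℕ} (h0 : m + 1 < k) : gapSum m k = k - 2 := by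
  rw [gapSum, if_neg (by omega), if_neg (by omega)]

/-- The product vanishes on the support of the indicator; it is `s` in row `0` and `-κ` in row `m +
1`. By skew-symmetry the indicator thus has nonnegative payoff against every move, and this is where
`s ≤ 0` enters. -/
lemma hardMatrix_mulVec_gap {m : ℕ} (hm : 2 ≤ m) {κ s : ℝ} (hκ : 0 ≤ κ) (hs : s ≤ 0)
    (k : Fin (2 * m + 1)) :
    (hardMatrix (2 * m + 1) κ s).mulVec
      (fun j => gapSum m (j + 1) - gapSum m j) k ≤ 0 := by
  have hk2 := k.2
  have g0 : gapSum m 0 = 0 := if_pos rfl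
  have gn : gapSum m (2 * m + 1) = 2 * m - 1 := by
    rw [gapSum_high (by omega)]
    push_cast
    ring
  have gn' : gapSum m (2 * m) = 2 * m - 2 := by
    rw [gapSum_high (by omega)]
    push_cast
    ring
  have g1 : gapSum m 1 = 0 := by
    rw [gapSum_low le_rfl (by omega)]
    norm_num
  by_cases h0 : (k : ℕ) = 0
  · rw [hardMatrix_mulVec_first hm _ _ _ _ h0, gapSum_low (by omega) le_rfl, g1, gn, gn']
    push_cast
    linarith
  by_cases h1 : (k : ℕ) = 2 * m
  · rw [hardMatrix_mulVec_last hm _ _ _ _ h1, gapSum_low (by omega) (by omega), g1, gn', g0]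
    linarith
  by_cases h2 : (k : ℕ) ≤ m
  · rw [hardMatrix_mulVec_low _ _ _ _ (by omega) (by omega) (by omega),
      gapSum_high (by omega), gapSum_low (by omega) (by omega),
      gapSum_low (by omega) (by omega), g0, gn]
    push_cast
    linarith
  by_cases h3 : (k : ℕ) = m + 1
  · rw [hardMatrix_mulVec_high _ _ _ _ (by omega) (by omega) (by omega), h3,
      show m + 1 - m = 1 by omega, gn, gapSum_high (by omega), gapSum_low (by omega) le_rfl, g1, g0]
    push_cast
    linarith
  · rw [hardMatrix_mulVec_high _ _ _ _ (by omega) (by omega) (by omega), gn, g0,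
      gapSum_high (by omega), gapSum_high (by omega), gapSum_low (by omega) (by omega),
      Nat.cast_sub (by omega)]
    push_cast
    linarith

lemma not_nonRedundant_hardMatrix {m : ℕ} (hm : 2 ≤ m) {κ s : ℝ} (hκ : 0 ≤ κ) (hs : s ≤ 0) :
    ¬ NonRedundant (hardMatrix (2 * m + 1) κ s) := by
  have hm' : (2 : ℝ) ≤ m := by exact_mod_cast hm
  intro h
  have hsum : ∑ i : Fin (2 * m + 1), (gapSum m (i + 1) - gapSum m i) = 2 * m - 1 := by
    rw [Fin.sum_univ_eq_sum_range (fun j => gapSum m (j + 1) - gapSum m j), Finset.sum_range_sub,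
      gapSum_high (by omega), gapSum, if_pos rfl]
    push_cast
    ring
  have hpos := h _ (isNash_inv_sum_smul (x := fun j => gapSum m (j + 1) - gapSum m j)
    (fun i => ?_) (by rw [hsum]; linarith) fun j => ?_) ⟨0, by omega⟩
  · simp [gapSum] at hpos
  · have hi := i.2
    rw [sub_nonneg]
    by_cases h0 : (i : ℕ) = 0
    · rw [h0, gapSum, if_pos rfl, gapSum_low (by omega) (by omega)]
      norm_num
    by_cases h1 : (i : ℕ) ≤ m
    · rw [gapSum_low (by omega) (by omega), gapSum_low (by omega) (by omega)]
      push_cast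
      linarith
    by_cases h2 : (i : ℕ) = m + 1
    · rw [gapSum_low (by omega) (by omega), gapSum_high (by omega)]
      push_cast
      linarith
    · rw [gapSum_high (by omega), gapSum_high (by omega)]
      push_cast
      linarith
  · rw [hardMatrix_vecMul]
    simpa using hardMatrix_mulVec_gap hm hκ hs j


/-! ### Binary relative entropy -/

/-- Tangent bound for `x * log x`. -/
lemma mul_log_tangent_le {x a : ℝ} (hx : 0 < x) (ha : 0 < a) :
    x * Real.log a + x - a ≤ x * Real.log x := by
  have h := Real.log_le_sub_one_of_pos (div_pos ha hx)
  rw [Real.log_div ha.ne' hx.ne'] at h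
  have h2 := mul_le_mul_of_nonneg_left h hx.le
  have h3 : x * (a / x - 1) = a - x := by field_simp
  rw [h3] at h2
  linarith

lemma neg_log_96_125 : -(133 / 500 : ℝ) ≤ Real.log (96 / 125) := by
  rw [Real.le_log_iff_exp_le (by norm_num), Real.exp_neg,
    inv_le_comm₀ (Real.exp_pos _) (by norm_num)]
  refine le_trans ?_ (Real.sum_le_exp_of_nonneg (by norm_num) 5)
  norm_num [Finset.sum_range_succ, Nat.factorial]

lemma le_log_204_125 : (243 / 500 : ℝ) ≤ Real.log (204 / 125) := by
  rw [Real.le_log_iff_exp_le (by norm_num)]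
  refine le_trans (Real.exp_bound' (by norm_num) (by norm_num) (n := 5) (by norm_num)) ?_
  norm_num [Finset.sum_range_succ, Nat.factorial]

/-- The binary relative entropy `kl(1 - δ, δ)` is at least `log (5 / (12 δ))`. -/
lemma log_le_binary_kl {δ : ℝ} (h0 : 0 < δ) (h1 : δ < 5 / 12) :
    Real.log (5 / (12 * δ)) ≤ (1 - 2 * δ) * Real.log ((1 - δ) / δ) := by
  have h1' : 0 < 1 - δ := by linarith
  have e1 : Real.log (5 / (12 * δ)) = Real.log (5 / 12) - Real.log δ := by
    rw [← Real.log_div (by norm_num) h0.ne']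
    congr 1
    field_simp
  rw [e1, Real.log_div h1'.ne' h0.ne']
  have ea : Real.log (8 / 25) = Real.log (96 / 125) + Real.log (5 / 12) := by
    rw [← Real.log_mul (by norm_num) (by norm_num)]
    norm_num
  have eb : Real.log (17 / 25) = Real.log (204 / 125) + Real.log (5 / 12) := by
    rw [← Real.log_mul (by norm_num) (by norm_num)]
    norm_num
  -- The difference of the two sides is `2 δ log δ + 2 (1 - δ) log (1 - δ) - log (1 - δ) - log (5 /
  -- 12)`, smallest near `δ = 8 / 25`. Tangents there bound it below by an affine function of `δ`,
  -- positive up to `5 / 12`; `96 / 125` and `204 / 125` are `8 / 25` and `17 / 25` divided by `5 /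
  -- 12`.
  have t1 := mul_log_tangent_le h0 (a := 8 / 25) (by norm_num)
  have t2 := mul_log_tangent_le h1' (a := 17 / 25) (by norm_num)
  have t3 := Real.log_le_sub_one_of_pos (div_pos h1' (show (0 : ℝ) < 17 / 25 by norm_num))
  rw [Real.log_div h1'.ne' (by norm_num)] at t3
  have na := mul_le_mul_of_nonneg_left neg_log_96_125 h0.le
  have nb := mul_le_mul_of_nonneg_left le_log_204_125 (show 0 ≤ 1 - 2 * δ by linarith)
  rw [ea] at t1
  rw [eb] at t2 t3
  nlinarith


/-! ### Tilted product measures -/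

/-- On a box, the indicator times the density is a product of functions of separate coordinates,
which are independent under the product measure. -/
lemma pi_withDensity {ι : Type*} [Fintype ι] {X : ι → Type*} [∀ i, MeasurableSpace (X i)]
    (μ : ∀ i, Measure (X i)) [∀ i, IsProbabilityMeasure (μ i)] {g : ∀ i, X i → ENNReal}
    (hg : ∀ i, Measurable (g i)) [∀ i, SigmaFinite ((μ i).withDensity (g i))] :
    Measure.pi (fun i => (μ i).withDensity (g i)) =
      (Measure.pi μ).withDensity (fun x => ∏ i, g i (x i)) := by
  symm
  refine (Measure.pi_eq fun s hs => ?_).symm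
  rw [withDensity_apply _ (MeasurableSet.univ_pi hs), ← lintegral_indicator
    (MeasurableSet.univ_pi hs)]
  have h1 : ∀ x : ∀ i, X i, (Set.univ.pi s).indicator (fun x => ∏ i, g i (x i)) x =
      ∏ i, (s i).indicator (g i) (x i) := by
    intro x
    by_cases hx : x ∈ Set.univ.pi s
    · rw [Set.indicator_of_mem hx]
      exact Finset.prod_congr rfl fun i _ => (Set.indicator_of_mem (hx i trivial) _).symm
    · rw [Set.indicator_of_notMem hx]
      simp only [Set.mem_pi, Set.mem_univ, true_implies, not_forall] at hx
      obtain ⟨i, hi⟩ := hx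
      exact (Finset.prod_eq_zero (Finset.mem_univ i) (Set.indicator_of_notMem hi _)).symm
  simp_rw [h1]
  have hind := iIndepFun_pi (μ := μ) (X := fun i => (s i).indicator (g i))
    (fun i => ((hg i).indicator (hs i)).aemeasurable)
  rw [lintegral_prod_eq_prod_lintegral_of_indepFun Finset.univ _ hind
    (fun i => ((hg i).indicator (hs i)).comp (measurable_pi_apply i))]
  refine Finset.prod_congr rfl fun i _ => ?_
  rw [withDensity_apply _ (hs i), ← lintegral_indicator (hs i)]
  exact (measurePreserving_eval μ i).lintegral_comp ((hg i).indicator (hs i))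

lemma pi_eq_withDensity_of_eq {ι : Type*} [Fintype ι] {X : ι → Type*}
    [∀ i, MeasurableSpace (X i)] {μ μ' : ∀ i, Measure (X i)} [∀ i, IsProbabilityMeasure (μ i)]
    [∀ i, IsProbabilityMeasure (μ' i)] {c : ι} (hne : ∀ i, i ≠ c → μ' i = μ i)
    {g : X c → ENNReal} (hg : Measurable g) (hc : μ' c = (μ c).withDensity g) :
    Measure.pi μ' = (Measure.pi μ).withDensity (fun x => g (x c)) := by
  classical
  let G : ∀ i, X i → ENNReal := fun i => if h : i = c then fun x => g (h ▸ x) else fun _ => 1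
  have hGc : G c = g := by simp [G]
  have hGne : ∀ i, i ≠ c → G i = fun _ => 1 := fun i hi => by simp [G, hi]
  have hGm : ∀ i, Measurable (G i) := by
    intro i
    by_cases hi : i = c
    · subst hi
      rwa [hGc]
    · rw [hGne i hi]
      exact measurable_const
  have hμ' : μ' = fun i => (μ i).withDensity (G i) := by
    funext i
    by_cases hi : i = c
    · subst hi
      rw [hGc, hc]
    · rw [hGne i hi, hne i hi, withDensity_const, one_smul]
  have : ∀ i, SigmaFinite ((μ i).withDensity (G i)) := fun i => by
    rw [← congrFun hμ' i]
    infer_instance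
  rw [hμ', pi_withDensity μ hGm]
  congr 1
  funext x
  rw [Finset.prod_eq_single c (fun i _ hi => by rw [hGne i hi]) (by simp), hGc]

/-- The exponent is minus the log-likelihood ratio of `N(a, 1)` to `N(b, 1)`, which is affine
because the variances agree; its mean under `N(a, 1)` is `(a - b)² / 2`. -/
lemma gaussianReal_eq_withDensity (a b : ℝ) :
    gaussianReal b 1 = (gaussianReal a 1).withDensity
      (fun x => ENNReal.ofReal (Real.exp (-((a - b) * x + (b ^ 2 - a ^ 2) / 2)))) := by
  rw [gaussianReal_of_var_ne_zero _ one_ne_zero, gaussianReal_of_var_ne_zero _ one_ne_zero,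
    ← withDensity_mul _ (measurable_gaussianPDF _ _) (by fun_prop)]
  congr 1
  funext x
  rw [Pi.mul_apply, gaussianPDF, gaussianPDF, ← ENNReal.ofReal_mul (gaussianPDFReal_nonneg _ _ _),
    gaussianPDFReal, gaussianPDFReal, mul_assoc _ (Real.exp _) (Real.exp _), ← Real.exp_add]
  congr 3
  simp only [NNReal.coe_one]
  ring

lemma integral_gaussianReal_affine (a u w : ℝ) :
    ∫ x, (u * x + w) ∂(gaussianReal a 1) = u * a + w := by
  have hi : Integrable (fun x : ℝ => x) (gaussianReal a 1) :=
    (memLp_id_gaussianReal (μ := a) (v := 1) 1).integrable (by simp)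
  rw [integral_add (hi.const_mul u) (integrable_const w), integral_const_mul,
    integral_id_gaussianReal]
  simp

lemma isSubGaussian_gaussianReal (a : ℝ) : IsSubGaussian a (gaussianReal a 1) := by
  refine ⟨(memLp_id_gaussianReal (μ := a) (v := 1) 1).integrable (by simp),
    integral_id_gaussianReal, fun c hc => ?_⟩
  have hmap : (gaussianReal a 1).map (fun x => x - a) = gaussianReal 0 1 := by
    rw [gaussianReal_map_sub_const, sub_self]
  have hmap' : (gaussianReal a 1).map (fun x => a - x) = gaussianReal 0 1 := by
    rw [gaussianReal_map_const_sub, sub_self]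
  -- One-sided Chernoff bound, applied below to `x - a` and to `a - x`.
  have key : ∀ X : ℝ → ℝ, Measurable X → (gaussianReal a 1).map X = gaussianReal 0 1 →
      (gaussianReal a 1).real {x | c ≤ X x} ≤ Real.exp (-c ^ 2 / 2) := by
    intro X hX h
    have hs : HasSubgaussianMGF X 1 (gaussianReal a 1) := by
      refine ⟨fun t => ?_, fun t => ?_⟩
      · have := integrable_exp_mul_gaussianReal (μ := 0) (v := 1) t
        rw [← h] at this
        exact this.comp_measurable hX
      · rw [mgf_gaussianReal h]
        simp
    simpa using hs.measure_ge_le hc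
  have h1 := key _ (by fun_prop) hmap
  have h2 := key _ (by fun_prop) hmap'
  have hsub : {x | c ≤ |x - a|} ⊆ {x | c ≤ x - a} ∪ {x | c ≤ a - x} := by
    intro x hx
    rcases le_abs.1 (show c ≤ |x - a| from hx) with h | h
    · exact Or.inl h
    · exact Or.inr (by simpa using h)
  calc _ ≤ (gaussianReal a 1).real ({x | c ≤ x - a} ∪ {x | c ≤ a - x}) := measureReal_mono hsub
    _ ≤ _ := measureReal_union_le _ _
    _ ≤ _ := by linarith

/-! ### Finite histories -/

namespace Algorithm

variable {n : ℕ} {Ω : Type*} [MeasurableSpace Ω]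

/-- The seed and the results of the first `t` rounds. -/
def history (t : ℕ) (z : Ω × (ℕ → Round n)) : Ω × (Fin t → Round n) := (z.1, fun i => z.2 i)

lemma measurable_history (t : ℕ) : Measurable (history (n := n) (Ω := Ω) t) := by
  unfold history
  fun_prop

instance (𝒜 : Algorithm n Ω) (ν : Pair n → ProbabilityMeasure ℝ) :
    IsProbabilityMeasure (𝒜.law ν) := by
  unfold law
  infer_instance

lemma law_map_history (𝒜 : Algorithm n Ω) (ν : Pair n → ProbabilityMeasure ℝ) (t : ℕ) :
    (𝒜.law ν).map (history t) = (𝒜.seedLaw : Measure Ω).prod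
      (Measure.pi fun _ : Fin t => Measure.pi fun p : Pair n => (ν p : Measure ℝ)) := by
  have h : MeasurePreserving (fun (x : ℕ → Round n) (i : Fin t) => x i)
      (Measure.infinitePi fun _ : ℕ => Measure.pi fun p : Pair n => (ν p : Measure ℝ))
      (Measure.pi fun _ : Fin t => Measure.pi fun p : Pair n => (ν p : Measure ℝ)) := by
    refine ⟨by fun_prop, ?_⟩
    rw [Measure.map_infinitePi_infinitePi_of_inj (f := fun i : Fin t => (i : ℕ))
      Fin.val_injective, Measure.infinitePi_eq_pi]
  exact ((MeasurePreserving.id (𝒜.seedLaw : Measure Ω)).prod h).map_eq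

/-- Change of measure on the events of the first `t` rounds. -/
lemma lintegral_history_change (𝒜 : Algorithm n Ω) {ν ν' : Pair n → ProbabilityMeasure ℝ}
    {c : Pair n} (hne : ∀ p, p ≠ c → ν' p = ν p) {g : ℝ → ENNReal} (hg : Measurable g)
    (hc : (ν' c : Measure ℝ) = (ν c : Measure ℝ).withDensity g) (t : ℕ)
    {h : Ω × (Fin t → Round n) → ENNReal} (hh : Measurable h) :
    ∫⁻ z, h (history t z) ∂(𝒜.law ν') =
      ∫⁻ z, h (history t z) * ∏ i ∈ Finset.range t, g (z.2 i c) ∂(𝒜.law ν) := by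
  have hround := pi_eq_withDensity_of_eq (μ := fun p => (ν p : Measure ℝ))
    (μ' := fun p => (ν' p : Measure ℝ)) (fun p hp => by rw [hne p hp]) hg hc
  have hgm : Measurable fun r : Round n => g (r c) := by fun_prop
  have hG : Measurable fun x : Fin t → Round n => ∏ i, g (x i c) := by fun_prop
  have : SigmaFinite ((Measure.pi fun p : Pair n => (ν p : Measure ℝ)).withDensity
      fun r => g (r c)) := by
    rw [← hround]
    infer_instance
  have hpi : (Measure.pi fun _ : Fin t => Measure.pi fun p : Pair n => (ν' p : Measure ℝ)) =
      (Measure.pi fun _ : Fin t => Measure.pi fun p : Pair n => (ν p : Measure ℝ)).withDensity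
        fun x => ∏ i, g (x i c) := by
    rw [hround]
    exact pi_withDensity (fun _ : Fin t => Measure.pi fun p : Pair n => (ν p : Measure ℝ))
      (g := fun _ r => g (r c)) fun _ => hgm
  have : SigmaFinite ((Measure.pi fun _ : Fin t =>
      Measure.pi fun p : Pair n => (ν p : Measure ℝ)).withDensity
        fun x => ∏ i, g (x i c)) := by
    rw [← hpi]
    infer_instance
  rw [← lintegral_map hh (measurable_history t), law_map_history, hpi,
    prod_withDensity_right hG, lintegral_withDensity_eq_lintegral_mul _ (by fun_prop) hh,
    ← law_map_history, lintegral_map (by fun_prop) (measurable_history t)]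
  refine lintegral_congr fun z => ?_
  rw [Pi.mul_apply, mul_comm]
  congr 1
  exact Fin.prod_univ_eq_prod_range (fun i => g (z.2 i c)) t

lemma measurePreserving_result (𝒜 : Algorithm n Ω) (ν : Pair n → ProbabilityMeasure ℝ)
    (c : Pair n) (t : ℕ) :
    MeasurePreserving (fun z : Ω × (ℕ → Round n) => z.2 t c) (𝒜.law ν) (ν c : Measure ℝ) :=
  ((measurePreserving_eval (fun p : Pair n => (ν p : Measure ℝ)) c).comp
    (measurePreserving_eval_infinitePi
      (fun _ : ℕ => Measure.pi fun p : Pair n => (ν p : Measure ℝ)) t)).comp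
    measurePreserving_snd

/-- Rounds are numbered from `0`, so the history of length `t` ends just before round `t`. For a
fixed seed this is independence of disjoint sets of coordinates; Fubini then averages over the seed.
-/
lemma indepFun_history_result (𝒜 : Algorithm n Ω) (ν : Pair n → ProbabilityMeasure ℝ)
    (c : Pair n) (t : ℕ) :
    IndepFun (history t) (fun z : Ω × (ℕ → Round n) => z.2 t c) (𝒜.law ν) := by
  let Q : Measure (ℕ → Round n) :=
    Measure.infinitePi fun _ : ℕ => Measure.pi fun p : Pair n => (ν p : Measure ℝ)
  have hind : IndepFun (fun (x : ℕ → Round n) (i : Fin t) => x i) (fun x => x t c) Q := by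
    have h := (iIndepFun_infinitePi (X := fun (_ : ℕ) (r : Round n) => r)
      (P := fun _ : ℕ => Measure.pi fun p : Pair n => (ν p : Measure ℝ))
      (fun _ => measurable_id)).indepFun_finset (Finset.range t) {t} (by simp)
      (fun i => measurable_pi_apply i)
    exact h.comp (φ := fun y (i : Fin t) => y ⟨i, Finset.mem_range.2 i.2⟩)
      (ψ := fun y => y ⟨t, Finset.mem_singleton_self t⟩ c) (by fun_prop) (by fun_prop)
  rw [indepFun_iff_measure_inter_preimage_eq_mul]
  intro A B hA hB
  have hAB : MeasurableSet (history t ⁻¹' A ∩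
      (fun z : Ω × (ℕ → Round n) => z.2 t c) ⁻¹' B) :=
    (measurable_history t hA).inter ((by fun_prop : Measurable
      (fun z : Ω × (ℕ → Round n) => z.2 t c)) hB)
  have hBm : Measurable fun x : ℕ → Round n => x t c := by fun_prop
  have e2 : 𝒜.law ν ((fun z : Ω × (ℕ → Round n) => z.2 t c) ⁻¹' B) =
      Q ((fun x => x t c) ⁻¹' B) := by
    exact measurePreserving_snd.measure_preimage (hBm hB).nullMeasurableSet
  rw [e2, law, Measure.prod_apply hAB, Measure.prod_apply (measurable_history t hA),
    ← lintegral_mul_const' _ _ (measure_ne_top _ _)]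
  refine lintegral_congr fun ω => ?_
  exact hind.measure_inter_preimage_eq_mul (Prod.mk ω ⁻¹' A) B (measurable_prodMk_left hA) hB

/-- The histories on which the algorithm has not stopped before round `t`. -/
def aliveSet (𝒜 : Algorithm n Ω) (t : ℕ) : Set (Ω × (Fin t → Round n)) :=
  {w | ∀ s, ∀ h : s < t, 𝒜.act s (w.1, fun i => w.2 (i.castLE h.le)) = Verdict.goOn}

/-- The algorithm does not stop before round `t`. -/
def Alive (𝒜 : Algorithm n Ω) (t : ℕ) (z : Ω × (ℕ → Round n)) : Prop :=
  ∀ s < t, 𝒜.actAt s z = Verdict.goOn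

lemma history_mem_aliveSet {𝒜 : Algorithm n Ω} {t : ℕ} {z : Ω × (ℕ → Round n)} :
    history t z ∈ 𝒜.aliveSet t ↔ 𝒜.Alive t z := Iff.rfl

lemma measurableSet_aliveSet (𝒜 : Algorithm n Ω) (t : ℕ) : MeasurableSet (𝒜.aliveSet t) := by
  have : 𝒜.aliveSet t = ⋂ s, ⋂ h : s < t,
      (fun w : Ω × (Fin t → Round n) => 𝒜.act s (w.1, fun i => w.2 (i.castLE h.le))) ⁻¹'
        {Verdict.goOn} := by
    ext w
    simp [aliveSet]
  rw [this]
  refine MeasurableSet.iInter fun s => MeasurableSet.iInter fun h => ?_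
  exact ((𝒜.measurable_act s).comp (by fun_prop)) trivial

lemma measurableSet_alive (𝒜 : Algorithm n Ω) (t : ℕ) : MeasurableSet {z | 𝒜.Alive t z} :=
  measurable_history t (𝒜.measurableSet_aliveSet t)

/-- The algorithm stops after `t` rounds with a verdict in `V`. -/
def StopsIn (𝒜 : Algorithm n Ω) (V : Set Verdict) (t : ℕ) (z : Ω × (ℕ → Round n)) : Prop :=
  𝒜.Alive t z ∧ 𝒜.actAt t z ∈ V

/-- The histories on which the algorithm stops after `t` rounds with a verdict in `V`. -/
def stopSet (𝒜 : Algorithm n Ω) (V : Set Verdict) (t : ℕ) : Set (Ω × (Fin t → Round n)) :=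
  𝒜.aliveSet t ∩ 𝒜.act t ⁻¹' V

lemma measurableSet_stopSet (𝒜 : Algorithm n Ω) (V : Set Verdict) (t : ℕ) :
    MeasurableSet (𝒜.stopSet V t) :=
  (𝒜.measurableSet_aliveSet t).inter (𝒜.measurable_act t trivial)

lemma measurableSet_stopsIn (𝒜 : Algorithm n Ω) (V : Set Verdict) (t : ℕ) :
    MeasurableSet {z | 𝒜.StopsIn V t z} :=
  measurable_history t (𝒜.measurableSet_stopSet V t)

lemma alive_succ {𝒜 : Algorithm n Ω} {t : ℕ} {z : Ω × (ℕ → Round n)} :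
    𝒜.Alive (t + 1) z ↔ 𝒜.Alive t z ∧ 𝒜.actAt t z = Verdict.goOn :=
  ⟨fun h => ⟨fun s hs => h s (by omega), h t (by omega)⟩, fun h s hs => by
    rcases Nat.lt_succ_iff_lt_or_eq.1 hs with h' | rfl
    · exact h.1 s h'
    · exact h.2⟩

lemma Alive.mono {𝒜 : Algorithm n Ω} {s t : ℕ} {z : Ω × (ℕ → Round n)} (h : 𝒜.Alive t z)
    (hst : s ≤ t) : 𝒜.Alive s z :=
  fun r hr => h r (hr.trans_le hst)

lemma exists_alive (𝒜 : Algorithm n Ω) (T : ℕ) (z : Ω × (ℕ → Round n)) :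
    𝒜.Alive T z ∨ ∃ t < T, 𝒜.StopsIn {Verdict.goOn}ᶜ t z := by
  induction T with
  | zero => exact Or.inl fun s hs => absurd hs (Nat.not_lt_zero s)
  | succ T ih =>
    rcases ih with h | ⟨t, ht, h⟩
    · by_cases h' : 𝒜.actAt T z = Verdict.goOn
      · exact Or.inl (alive_succ.2 ⟨h, h'⟩)
      · exact Or.inr ⟨T, by omega, h, h'⟩
    · exact Or.inr ⟨t, by omega, h⟩

lemma StopsIn.alive_iff {𝒜 : Algorithm n Ω} {V : Set Verdict} (hV : Verdict.goOn ∉ V) {t : ℕ}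
    {z : Ω × (ℕ → Round n)} (h : 𝒜.StopsIn V t z) {s : ℕ} : 𝒜.Alive s z ↔ s ≤ t :=
  ⟨fun hs => not_lt.1 fun hlt => hV (hs t hlt ▸ h.2), fun hs => h.1.mono hs⟩

lemma StopsIn.eq {𝒜 : Algorithm n Ω} {V W : Set Verdict} (hV : Verdict.goOn ∉ V)
    (hW : Verdict.goOn ∉ W) {s t : ℕ} {z : Ω × (ℕ → Round n)} (hs : 𝒜.StopsIn V s z)
    (ht : 𝒜.StopsIn W t z) : s = t :=
  le_antisymm ((ht.alive_iff hW).1 hs.1) ((hs.alive_iff hV).1 ht.1)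

lemma sum_measure_stopsIn_add (𝒜 : Algorithm n Ω) (P : Measure (Ω × (ℕ → Round n)))
    [IsProbabilityMeasure P] (T : ℕ) :
    ∑ t ∈ Finset.range T, P {z | 𝒜.StopsIn {Verdict.goOn}ᶜ t z} + P {z | 𝒜.Alive T z} = 1 := by
  induction T with
  | zero => simp [Alive]
  | succ T ih =>
    rw [← ih, Finset.sum_range_succ, add_assoc]
    congr 1
    rw [← measure_union _ (𝒜.measurableSet_alive _)]
    · congr 1
      ext z
      simp only [Set.mem_union, Set.mem_ofPred_eq, alive_succ, StopsIn, Set.mem_compl_iff,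
        Set.mem_singleton_iff]
      tauto
    · rw [Set.disjoint_left]
      intro z hz hz'
      exact hz.2 (alive_succ.1 hz').2

/-- `Alive (i + 1)` says that the stopping time exceeds `i`, so this is the tail formula for the
expectation, cut off at `T`. -/
lemma sum_measure_alive_le_expectedTime (𝒜 : Algorithm n Ω) (ν : Pair n → ProbabilityMeasure ℝ)
    (T : ℕ) :
    ∑ i ∈ Finset.range T, 𝒜.law ν {z | 𝒜.Alive (i + 1) z} ≤ 𝒜.expectedTime ν := by
  classical
  have h1 : ∀ i, 𝒜.law ν {z | 𝒜.Alive (i + 1) z} =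
      ∫⁻ z, {z | 𝒜.Alive (i + 1) z}.indicator 1 z ∂(𝒜.law ν) := fun i =>
    (lintegral_indicator_one (𝒜.measurableSet_alive _)).symm
  simp_rw [h1]
  rw [← lintegral_finsetSum _ fun i _ => measurable_one.indicator (𝒜.measurableSet_alive _)]
  refine lintegral_mono fun z => ?_
  have hle : ((∑ i ∈ Finset.range T, if 𝒜.Alive (i + 1) z then 1 else 0 : ℕ) : ℕ∞) ≤
      𝒜.stoppingTime z := by
    refine le_iInf₂ fun t ht => ?_
    rw [Nat.cast_le, ← Finset.card_filter]
    calc _ ≤ (Finset.range t).card := Finset.card_le_card fun i hi => by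
          rw [Finset.mem_filter] at hi
          exact Finset.mem_range.2 (not_le.1 fun h => ht (hi.2 t (by omega)))
      _ = t := Finset.card_range t
  have hle' := ENat.toENNReal_le.2 hle
  refine le_trans (le_of_eq ?_) hle'
  rw [ENat.toENNReal_coe]
  push_cast
  refine Finset.sum_congr rfl fun i _ => ?_
  simp [Set.indicator_apply]

/-! ### Stopped likelihood ratios -/

/-- Predictability: whether round `t` is played is decided by the history before it, hence
independently of its results. Wald's identity rests on this. -/
lemma setOf_alive_succ (𝒜 : Algorithm n Ω) (t : ℕ) :
    {z | 𝒜.Alive (t + 1) z} = history t ⁻¹' 𝒜.stopSet {Verdict.goOn} t := by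
  ext z
  exact alive_succ

/-- Wald's identity, for one round. -/
lemma integral_indicator_alive_mul (𝒜 : Algorithm n Ω) (ν : Pair n → ProbabilityMeasure ℝ)
    (c : Pair n) {l : ℝ → ℝ} (hl : Measurable l) (t : ℕ) :
    ∫ z, {z | 𝒜.Alive (t + 1) z}.indicator (1 : Ω × (ℕ → Round n) → ℝ) z * l (z.2 t c) ∂(𝒜.law ν) =
      (𝒜.law ν).real {z | 𝒜.Alive (t + 1) z} * ∫ x, l x ∂(ν c : Measure ℝ) := by
  have hS := 𝒜.measurableSet_stopSet {Verdict.goOn} t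
  have hind := (𝒜.indepFun_history_result ν c t).comp
    (φ := (𝒜.stopSet {Verdict.goOn} t).indicator (1 : Ω × (Fin t → Round n) → ℝ)) (ψ := l)
    (measurable_one.indicator hS) hl
  have h := hind.integral_fun_mul_eq_mul_integral
    (((measurable_one.indicator hS).comp (measurable_history t)).aestronglyMeasurable)
    ((hl.comp (𝒜.measurePreserving_result ν c t).measurable).aestronglyMeasurable)
  rw [setOf_alive_succ]
  refine h.trans ?_
  congr 1
  · exact integral_indicator_one (measurable_history t hS)
  · have := (𝒜.measurePreserving_result ν c t).map_eq
    rw [← this, integral_map (𝒜.measurePreserving_result ν c t).measurable.aemeasurable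
      hl.aestronglyMeasurable]
    rfl

lemma sum_measure_stopsIn_le (𝒜 : Algorithm n Ω) (P : Measure (Ω × (ℕ → Round n)))
    {v : Verdict} (hv : v ≠ Verdict.goOn) (T : ℕ) :
    ∑ t ∈ Finset.range T, P {z | 𝒜.StopsIn {v} t z} ≤ P {z | ∃ t, 𝒜.StopsIn {v} t z} := by
  rw [← measure_biUnion_finset _ fun t _ => 𝒜.measurableSet_stopsIn {v} t]
  · refine measure_mono fun z hz => ?_
    simp only [Set.mem_iUnion] at hz
    obtain ⟨t, _, ht⟩ := hz
    exact ⟨t, ht⟩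
  · intro s _ t _ hst
    rw [Function.onFun, Set.disjoint_left]
    intro z hs ht
    exact hst (StopsIn.eq (by simpa using hv.symm) (by simpa using hv.symm) hs ht)

/-- The log-likelihood ratio, stopped at time `min τ T`. -/
noncomputable def stoppedSum (𝒜 : Algorithm n Ω) (c : Pair n) (l : ℝ → ℝ) (T : ℕ)
    (z : Ω × (ℕ → Round n)) : ℝ :=
  ∑ i ∈ Finset.range T, {z | 𝒜.Alive (i + 1) z}.indicator (1 : Ω × (ℕ → Round n) →
    ℝ) z * l (z.2 i c)

lemma integrable_stoppedSum_term (𝒜 : Algorithm n Ω) (ν : Pair n → ProbabilityMeasure ℝ)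
    (c : Pair n) {l : ℝ → ℝ} (hi : Integrable l (ν c : Measure ℝ)) (i : ℕ) :
    Integrable (fun z => {z | 𝒜.Alive (i + 1) z}.indicator (1 : Ω × (ℕ → Round n) →
      ℝ) z * l (z.2 i c))
      (𝒜.law ν) := by
  have h := ((𝒜.measurePreserving_result ν c i).integrable_comp_of_integrable hi).indicator
    (𝒜.measurableSet_alive (i + 1))
  refine h.congr (Filter.Eventually.of_forall fun z => ?_)
  by_cases hz : z ∈ {z | 𝒜.Alive (i + 1) z} <;> simp [Set.indicator, hz]

lemma integral_stoppedSum (𝒜 : Algorithm n Ω) (ν : Pair n → ProbabilityMeasure ℝ)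
    (c : Pair n) {l : ℝ → ℝ} (hl : Measurable l) (hi : Integrable l (ν c : Measure ℝ)) (T : ℕ) :
    ∫ z, 𝒜.stoppedSum c l T z ∂(𝒜.law ν) =
      (∑ i ∈ Finset.range T, (𝒜.law ν).real {z | 𝒜.Alive (i + 1) z}) *
        ∫ x, l x ∂(ν c : Measure ℝ) := by
  unfold stoppedSum
  rw [integral_finsetSum _ fun i _ => 𝒜.integrable_stoppedSum_term ν c hi i, Finset.sum_mul]
  exact Finset.sum_congr rfl fun i _ => 𝒜.integral_indicator_alive_mul ν c hl i

lemma stoppedSum_of_alive {𝒜 : Algorithm n Ω} {c : Pair n} {l : ℝ → ℝ} {T t : ℕ}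
    {z : Ω × (ℕ → Round n)} (htT : t ≤ T) (h : ∀ i < T, 𝒜.Alive (i + 1) z ↔ i < t) :
    𝒜.stoppedSum c l T z = ∑ i ∈ Finset.range t, l (z.2 i c) := by
  unfold stoppedSum
  rw [← Finset.sum_subset (Finset.range_mono htT)]
  · refine Finset.sum_congr rfl fun i hi => ?_
    have hit := Finset.mem_range.1 hi
    rw [Set.indicator_of_mem (show z ∈ {z | 𝒜.Alive (i + 1) z} from
      (h i (hit.trans_le htT)).2 hit), Pi.one_apply, one_mul]
  · intro i hi hit
    rw [Finset.mem_range] at hi hit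
    rw [Set.indicator_of_notMem (show z ∉ {z | 𝒜.Alive (i + 1) z} from
      fun hz => hit ((h i hi).1 hz)), zero_mul]

/-- The exponential reward for a verdict in the first `T` rounds, discounted by the stopped
likelihood ratio, is bounded by a sum over the possible stopping times. -/
lemma exp_sub_stoppedSum_le (𝒜 : Algorithm n Ω) (c : Pair n) (l : ℝ → ℝ) {v : Verdict}
    (hv : v ≠ Verdict.goOn) {b : ℝ} (hb : 0 ≤ b) (T : ℕ) (z : Ω × (ℕ → Round n)) :
    ENNReal.ofReal (Real.exp (b * {z | ∃ t < T,
      𝒜.StopsIn {v} t z}.indicator (1 : Ω × (ℕ → Round n) → ℝ) z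
        - 𝒜.stoppedSum c l T z)) ≤
      ∑ t ∈ Finset.range T,
        ((𝒜.stopSet {Verdict.goOn}ᶜ t).indicator (1 : Ω × (Fin t → Round n) → ENNReal) (history t z)
          + ENNReal.ofReal (Real.exp b - 1) *
            (𝒜.stopSet {v} t).indicator (1 : Ω × (Fin t → Round n) → ENNReal) (history t z)) *
          ∏ i ∈ Finset.range t, ENNReal.ofReal (Real.exp (-l (z.2 i c)))
      + (𝒜.aliveSet T).indicator (1 : Ω × (Fin T → Round n) → ENNReal) (history T z) *
          ∏ i ∈ Finset.range T, ENNReal.ofReal (Real.exp (-l (z.2 i c))) := by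
  have hprod : ∀ t, ∏ i ∈ Finset.range t, ENNReal.ofReal (Real.exp (-l (z.2 i c))) =
      ENNReal.ofReal (Real.exp (-∑ i ∈ Finset.range t, l (z.2 i c))) := fun t => by
    rw [← ENNReal.ofReal_prod_of_nonneg fun i _ => (Real.exp_pos _).le, ← Real.exp_sum,
      Finset.sum_neg_distrib]
  simp_rw [hprod]
  have hvV : Verdict.goOn ∉ ({v} : Set Verdict) := by simpa using hv.symm
  have hgV : Verdict.goOn ∉ ({Verdict.goOn}ᶜ : Set Verdict) := by simp
  -- If the algorithm has not stopped before `T`, the last term alone equals the left side; if it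
  -- stops at `t < T`, the summand of `t` does. The other terms are nonnegative.
  rcases 𝒜.exists_alive T z with h | ⟨t, ht, h⟩
  · refine le_trans (le_of_eq ?_) le_add_self
    rw [Set.indicator_of_mem (history_mem_aliveSet.2 h), Set.indicator_of_notMem,
      stoppedSum_of_alive le_rfl fun i hi => ⟨fun _ => hi, fun _ => h.mono hi⟩]
    · simp
    · rintro ⟨t, ht, hz⟩
      exact absurd ((hz.alive_iff hvV).1 h) (by omega)
  · refine le_trans ?_ le_self_add
    refine le_trans ?_ (Finset.single_le_sum (fun _ _ => zero_le) (Finset.mem_range.2 ht))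
    rw [Set.indicator_of_mem (show history t z ∈ 𝒜.stopSet {Verdict.goOn}ᶜ t from h),
      stoppedSum_of_alive ht.le fun i _ => (h.alive_iff hgV).trans Nat.succ_le_iff]
    by_cases hz : 𝒜.StopsIn {v} t z
    · rw [Set.indicator_of_mem (show z ∈ {z | ∃ t < T, 𝒜.StopsIn {v} t z} from ⟨t, ht, hz⟩),
        Set.indicator_of_mem (show history t z ∈ 𝒜.stopSet {v} t from hz)]
      simp only [Pi.one_apply, mul_one]
      rw [← ENNReal.ofReal_one, ← ENNReal.ofReal_add zero_le_one
        (by linarith [Real.one_le_exp hb]), ← ENNReal.ofReal_mul (by linarith [Real.exp_pos b]),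
        sub_eq_add_neg, Real.exp_add]
      refine le_of_eq ?_
      congr 2
      ring
    · rw [Set.indicator_of_notMem]
      · simp [show history t z ∉ 𝒜.stopSet {v} t from hz]
      · rintro ⟨s, _, hs⟩
        exact hz (StopsIn.eq hvV hgV hs h ▸ hs)

/-- The information inequality for a stopped sequence of results of one pair. -/
lemma mul_measure_stopsIn_le (𝒜 : Algorithm n Ω) {ν ν' : Pair n → ProbabilityMeasure ℝ}
    {c : Pair n} (hne : ∀ p, p ≠ c → ν' p = ν p) {l : ℝ → ℝ} (hl : Measurable l)
    (hi : Integrable l (ν c : Measure ℝ))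
    (hc : (ν' c : Measure ℝ) =
      (ν c : Measure ℝ).withDensity fun x => ENNReal.ofReal (Real.exp (-l x)))
    {v : Verdict} (hv : v ≠ Verdict.goOn) {b δ : ℝ} (hb : 0 ≤ b) (hδ0 : 0 ≤ δ)
    (hδ : 𝒜.law ν' {z | ∃ t, 𝒜.StopsIn {v} t z} ≤ ENNReal.ofReal δ) (T : ℕ) :
    b * (𝒜.law ν).real {z | ∃ t < T, 𝒜.StopsIn {v} t z} ≤
      (∑ i ∈ Finset.range T, (𝒜.law ν).real {z | 𝒜.Alive (i + 1) z}) *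
        ∫ x, l x ∂(ν c : Measure ℝ) + Real.log (1 + (Real.exp b - 1) * δ) := by
  have hb1 : 0 ≤ Real.exp b - 1 := by linarith [Real.one_le_exp hb]
  set Z : ℝ := 1 + (Real.exp b - 1) * δ with hZdef
  have hZ : 0 < Z := by positivity
  have hg : Measurable fun x => ENNReal.ofReal (Real.exp (-l x)) := by fun_prop
  set E : Set (Ω × (ℕ → Round n)) := {z | ∃ t < T, 𝒜.StopsIn {v} t z} with hEdef
  have hE : MeasurableSet E := by
    have : E = ⋃ t, ⋃ _ : t < T, {z | 𝒜.StopsIn {v} t z} := by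
      ext z
      simp [hEdef]
    rw [this]
    exact MeasurableSet.iUnion fun t => MeasurableSet.iUnion fun _ =>
      𝒜.measurableSet_stopsIn {v} t
  -- Test function for the variational bound `E f ≤ log E (exp f)`: since `exp (-stoppedSum)` turns
  -- `ν` into `ν'` on stopped histories, `E (exp f)` is at most `Z`.
  set f : Ω × (ℕ → Round n) → ℝ := fun z =>
    b * E.indicator (1 : Ω × (ℕ → Round n) → ℝ) z - 𝒜.stoppedSum c l T z with hfdef
  have hSi : Integrable (𝒜.stoppedSum c l T) (𝒜.law ν) :=
    integrable_finsetSum _ fun i _ => 𝒜.integrable_stoppedSum_term ν c hi i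
  have hEi : Integrable (fun z => b * E.indicator (1 : Ω × (ℕ → Round n) → ℝ) z) (𝒜.law ν) :=
    ((integrable_const (1 : ℝ)).indicator hE).const_mul b
  have hfi : Integrable f (𝒜.law ν) := hEi.sub hSi
  have hlint : ∫⁻ z, ENNReal.ofReal (Real.exp (f z)) ∂(𝒜.law ν) ≤ ENNReal.ofReal Z := by
    have hhm : ∀ t, Measurable fun w : Ω × (Fin t → Round n) =>
        (𝒜.stopSet {Verdict.goOn}ᶜ t).indicator (1 : Ω × (Fin t → Round n) → ENNReal) w
          + ENNReal.ofReal (Real.exp b - 1) * (𝒜.stopSet {v} t).indicator (1 : Ω × (Fin t →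
            Round n) → ENNReal) w :=
      fun t => (measurable_one.indicator (𝒜.measurableSet_stopSet _ t)).add
        ((measurable_one.indicator (𝒜.measurableSet_stopSet _ t)).const_mul _)
    have hpm : ∀ t, Measurable fun z : Ω × (ℕ → Round n) =>
        ∏ i ∈ Finset.range t, ENNReal.ofReal (Real.exp (-l (z.2 i c))) := fun t => by fun_prop
    have ham : Measurable ((𝒜.aliveSet T).indicator (1 : Ω × (Fin T → Round n) → ENNReal)) :=
      measurable_one.indicator (𝒜.measurableSet_aliveSet T)
    refine (lintegral_mono fun z => 𝒜.exp_sub_stoppedSum_le c l hv hb T z).trans ?_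
    have hsum := fun t => ((hhm t).comp (measurable_history t)).mul (hpm t)
    have hlast := (ham.comp (measurable_history T)).mul (hpm T)
    simp only [Pi.mul_def, Function.comp_def] at hsum hlast
    rw [lintegral_add_right _ hlast, lintegral_finsetSum _ fun t _ => hsum t,
      -- The change of measure acts on each stopping time separately, where the likelihood ratio is
      -- a product over a fixed number of rounds. Under `ν'` the stopping events and survival to `T`
      -- have total mass `1`.
      ← 𝒜.lintegral_history_change hne hg hc T ham]
    simp_rw [fun t => (𝒜.lintegral_history_change hne hg hc t (hhm t)).symm]
    have h1 : ∀ (V : Set Verdict) (t : ℕ),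
        ∫⁻ z, (𝒜.stopSet V t).indicator (1 : Ω × (Fin t → Round n) →
          ENNReal) (history t z) ∂(𝒜.law ν') =
          𝒜.law ν' {z | 𝒜.StopsIn V t z} := fun V t =>
      lintegral_indicator_one (𝒜.measurableSet_stopsIn V t)
    have h2 : ∫⁻ z, (𝒜.aliveSet T).indicator (1 : Ω × (Fin T → Round n) →
      ENNReal) (history T z) ∂(𝒜.law ν') =
        𝒜.law ν' {z | 𝒜.Alive T z} := lintegral_indicator_one (𝒜.measurableSet_alive T)
    have hsm : ∀ (V : Set Verdict) (t : ℕ), Measurable fun z : Ω × (ℕ → Round n) =>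
        (𝒜.stopSet V t).indicator (1 : Ω × (Fin t → Round n) → ENNReal) (history t z) := fun V t =>
      (measurable_one.indicator (𝒜.measurableSet_stopSet V t)).comp (measurable_history t)
    simp_rw [fun t => lintegral_add_left (μ := 𝒜.law ν') (hsm {Verdict.goOn}ᶜ t)
      (fun z => ENNReal.ofReal (Real.exp b - 1) *
        (𝒜.stopSet {v} t).indicator (1 : Ω × (Fin t → Round n) → ENNReal) (history t z)),
      fun t => lintegral_const_mul (μ := 𝒜.law ν') (ENNReal.ofReal (Real.exp b - 1))
        (hsm {v} t), h1, h2]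
    rw [Finset.sum_add_distrib, ← Finset.mul_sum, add_right_comm, sum_measure_stopsIn_add, hZdef,
      ENNReal.ofReal_add zero_le_one (by positivity), ENNReal.ofReal_one, ENNReal.ofReal_mul hb1]
    gcongr
    exact (𝒜.sum_measure_stopsIn_le _ hv T).trans hδ
  have hexpi : Integrable (fun z => Real.exp (f z)) (𝒜.law ν) := by
    refine ⟨(Real.continuous_exp.comp_aestronglyMeasurable hfi.1), ?_⟩
    rw [hasFiniteIntegral_iff_ofReal (Filter.Eventually.of_forall fun z => (Real.exp_pos _).le)]
    exact hlint.trans_lt ENNReal.ofReal_lt_top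
  have hexp : ∫ z, Real.exp (f z) ∂(𝒜.law ν) ≤ Z := by
    rw [integral_eq_lintegral_of_nonneg_ae
      (Filter.Eventually.of_forall fun z => (Real.exp_pos _).le) hexpi.1]
    exact ENNReal.toReal_le_of_le_ofReal hZ.le hlint
  -- Jensen's inequality for the logarithm, through its tangent at `Z`: `f ≤ exp f / Z + log Z - 1`
  -- pointwise.
  have hmono : ∫ z, f z ∂(𝒜.law ν) ≤
      ∫ z, (Real.exp (f z) / Z + (Real.log Z - 1)) ∂(𝒜.law ν) := by
    refine integral_mono hfi ((hexpi.div_const Z).add (integrable_const _)) fun z => ?_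
    have h := Real.add_one_le_exp (f z - Real.log Z)
    rw [Real.exp_sub, Real.exp_log hZ] at h
    simp only
    linarith
  rw [integral_add (hexpi.div_const Z) (integrable_const _), integral_div, integral_const,
    probReal_univ, one_smul] at hmono
  have hfint : ∫ z, f z ∂(𝒜.law ν) = b * (𝒜.law ν).real E -
      (∑ i ∈ Finset.range T, (𝒜.law ν).real {z | 𝒜.Alive (i + 1) z}) *
        ∫ x, l x ∂(ν c : Measure ℝ) := by
    rw [← 𝒜.integral_stoppedSum ν c hl hi, hfdef, integral_sub hEi hSi, integral_const_mul,
      integral_indicator_one hE]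
  have hdiv := (div_le_one hZ).2 hexp
  linarith

/-! ### Lower bounds for the expected stopping time -/

lemma concludes_iff (𝒜 : Algorithm n Ω) {v : Verdict} (hv : v ≠ Verdict.goOn)
    (z : Ω × (ℕ → Round n)) : 𝒜.Concludes v z ↔ ∃ t, 𝒜.StopsIn {v} t z :=
  ⟨fun ⟨_, t, h1, h2⟩ => ⟨t, h2, h1⟩, fun ⟨t, h2, h1⟩ => ⟨hv, t, h1, h2⟩⟩

lemma measurableSet_concludes (𝒜 : Algorithm n Ω) {v : Verdict} (hv : v ≠ Verdict.goOn) :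
    MeasurableSet {z | 𝒜.Concludes v z} := by
  have : {z | 𝒜.Concludes v z} = ⋃ t, {z | 𝒜.StopsIn {v} t z} := by
    ext z
    simp [𝒜.concludes_iff hv]
  rw [this]
  exact MeasurableSet.iUnion fun t => 𝒜.measurableSet_stopsIn {v} t

lemma Concludes.unique {𝒜 : Algorithm n Ω} {v w : Verdict} {z : Ω × (ℕ → Round n)}
    (h : 𝒜.Concludes v z) (h' : 𝒜.Concludes w z) : v = w := by
  obtain ⟨s, hs⟩ := (𝒜.concludes_iff h.1 z).1 h
  obtain ⟨t, ht⟩ := (𝒜.concludes_iff h'.1 z).1 h'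
  obtain rfl := StopsIn.eq (by simpa using h.1.symm) (by simpa using h'.1.symm) hs ht
  exact hs.2.symm.trans ht.2

open Filter Topology in
/-- An algorithm that tells two models apart, which differ only in the law of one pair, needs many
rounds. -/
lemma ofReal_le_expectedTime (𝒜 : Algorithm n Ω) {ν ν' : Pair n → ProbabilityMeasure ℝ}
    {c : Pair n} (hne : ∀ p, p ≠ c → ν' p = ν p) {l : ℝ → ℝ} (hl : Measurable l)
    (hi : Integrable l (ν c : Measure ℝ))
    (hc : (ν' c : Measure ℝ) =
      (ν c : Measure ℝ).withDensity fun x => ENNReal.ofReal (Real.exp (-l x)))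
    (hpos : 0 < ∫ x, l x ∂(ν c : Measure ℝ))
    {v : Verdict} (hv : v ≠ Verdict.goOn) {b δ : ℝ} (hb : 0 ≤ b) (hδ0 : 0 ≤ δ)
    (hδ : 1 - δ ≤ (𝒜.law ν).real {z | 𝒜.Concludes v z})
    (hδ' : (𝒜.law ν').real {z | 𝒜.Concludes v z} ≤ δ) :
    ENNReal.ofReal ((b * (1 - δ) - Real.log (1 + (Real.exp b - 1) * δ)) /
      ∫ x, l x ∂(ν c : Measure ℝ)) ≤ 𝒜.expectedTime ν := by
  by_cases htop : 𝒜.expectedTime ν = ⊤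
  · rw [htop]
    exact le_top
  have hset : {z | 𝒜.Concludes v z} = {z | ∃ t, 𝒜.StopsIn {v} t z} := by
    ext z
    exact 𝒜.concludes_iff hv z
  rw [hset] at hδ hδ'
  have hδE : 𝒜.law ν' {z | ∃ t, 𝒜.StopsIn {v} t z} ≤ ENNReal.ofReal δ :=
    (ENNReal.le_ofReal_iff_toReal_le (measure_ne_top _ _) hδ0).2 hδ'
  have hT : ∀ T, b * (𝒜.law ν).real {z | ∃ t < T, 𝒜.StopsIn {v} t z} ≤
      (𝒜.expectedTime ν).toReal * ∫ x, l x ∂(ν c : Measure ℝ) +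
        Real.log (1 + (Real.exp b - 1) * δ) := fun T => by
    refine (𝒜.mul_measure_stopsIn_le hne hl hi hc hv hb hδ0 hδE T).trans ?_
    gcongr
    have := ENNReal.toReal_mono htop (𝒜.sum_measure_alive_le_expectedTime ν T)
    rwa [ENNReal.toReal_sum fun i _ => measure_ne_top _ _] at this
  have hlim : Tendsto (fun T => (𝒜.law ν).real {z | ∃ t < T, 𝒜.StopsIn {v} t z}) atTop
      (𝓝 ((𝒜.law ν).real {z | ∃ t, 𝒜.StopsIn {v} t z})) := by
    have hU : {z | ∃ t, 𝒜.StopsIn {v} t z} =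
        ⋃ T, {z | ∃ t < T, 𝒜.StopsIn {v} t z} := by
      ext z
      simp only [Set.mem_iUnion]
      exact ⟨fun ⟨t, h⟩ => ⟨t + 1, t, Nat.lt_succ_self t, h⟩, fun ⟨_, t, _, h⟩ => ⟨t, h⟩⟩
    rw [hU]
    refine (ENNReal.tendsto_toReal (measure_ne_top _ _)).comp
      (tendsto_measure_iUnion_atTop fun S T hST z => ?_)
    rintro ⟨t, ht, h⟩
    exact ⟨t, ht.trans_le hST, h⟩
  have hfin := le_of_tendsto' (hlim.const_mul b) hT
  refine ENNReal.ofReal_le_of_le_toReal ?_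
  rw [div_le_iff₀ hpos]
  have := mul_le_mul_of_nonneg_left hδ hb
  linarith

/-- The lower bound of `ofReal_le_expectedTime` for Gaussian laws of variance one. -/
lemma ofReal_le_expectedTime_of_gaussian (𝒜 : Algorithm n Ω)
    {ν ν' : Pair n → ProbabilityMeasure ℝ} {c : Pair n} (hne : ∀ p, p ≠ c → ν' p = ν p)
    {x y : ℝ} (hxy : x ≠ y) (hx : (ν c : Measure ℝ) = gaussianReal x 1)
    (hy : (ν' c : Measure ℝ) = gaussianReal y 1) {v w : Verdict} (hvw : v ≠ w)
    (hv : v ≠ Verdict.goOn) {δ : ℝ} (hδ0 : 0 < δ)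
    (hδ : 1 - δ ≤ (𝒜.law ν).real {z | 𝒜.Concludes v z})
    (hw : w ≠ Verdict.goOn) (hδ' : 1 - δ ≤ (𝒜.law ν').real {z | 𝒜.Concludes w z}) :
    ENNReal.ofReal (2 / (x - y) ^ 2 * Real.log (5 / (12 * δ))) ≤ 𝒜.expectedTime ν := by
  have hsq : 0 < (x - y) ^ 2 := by
    have := sub_ne_zero.2 hxy
    positivity
  -- For `δ ≥ 5 / 12` the logarithm is nonpositive and the bound is trivial.
  rcases le_or_gt (5 / 12) δ with h | h
  · rw [ENNReal.ofReal_of_nonpos]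
    · exact zero_le
    · refine mul_nonpos_of_nonneg_of_nonpos (by positivity)
        (Real.log_nonpos (by positivity) ?_)
      rw [div_le_one (by positivity)]
      linarith
  have hδ'' : (𝒜.law ν').real {z | 𝒜.Concludes v z} ≤ δ := by
    have h1 : (𝒜.law ν').real {z | 𝒜.Concludes v z} ≤
        (𝒜.law ν').real {z | 𝒜.Concludes w z}ᶜ :=
      measureReal_mono fun z hz hz' => hvw (Concludes.unique hz hz')
    rw [measureReal_compl (𝒜.measurableSet_concludes hw), probReal_univ] at h1
    linarith
  have hint : ∫ u, ((x - y) * u + (y ^ 2 - x ^ 2) / 2) ∂(ν c : Measure ℝ) =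
      (x - y) ^ 2 / 2 := by
    rw [hx, integral_gaussianReal_affine]
    ring
  have hr : 0 < (1 - δ) / δ := div_pos (by linarith) hδ0
  have hr1 : 1 ≤ (1 - δ) / δ := by
    rw [le_div_iff₀ hδ0]
    linarith
  have hmain := 𝒜.ofReal_le_expectedTime hne
    (l := fun u => (x - y) * u + (y ^ 2 - x ^ 2) / 2) (by fun_prop)
    (by
      rw [hx]
      exact (((memLp_id_gaussianReal (μ := x) (v := 1) 1).integrable (by simp)).const_mul
        (x - y)).add (integrable_const _))
    (by rw [hy, hx, gaussianReal_eq_withDensity x y])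
    -- This `b` maximizes `b (1 - δ) - log (1 + (exp b - 1) δ)`; the maximum is `kl(1 - δ, δ) = (1 -
    -- 2δ) log ((1 - δ) / δ)`.
    (by rw [hint]; positivity) hv (b := 2 * Real.log ((1 - δ) / δ))
    (mul_nonneg zero_le_two (Real.log_nonneg hr1)) hδ0.le hδ hδ''
  refine le_trans (ENNReal.ofReal_le_ofReal ?_) hmain
  have hexp : Real.exp (2 * Real.log ((1 - δ) / δ)) = ((1 - δ) / δ) ^ 2 := by
    rw [two_mul, Real.exp_add, Real.exp_log hr, sq]
  have hZ : 1 + (((1 - δ) / δ) ^ 2 - 1) * δ = (1 - δ) / δ := by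
    field_simp
    ring
  rw [hint, hexp, hZ]
  have hkl := log_le_binary_kl hδ0 h
  calc 2 / (x - y) ^ 2 * Real.log (5 / (12 * δ))
      ≤ 2 / (x - y) ^ 2 * ((1 - 2 * δ) * Real.log ((1 - δ) / δ)) := by gcongr
    _ = _ := by
      field_simp
      ring

end Algorithm
end DuelingBandit

open DuelingBandit
theorem theorem4 {n : ℕ} (hn : 5 ≤ n) (hodd : Odd n)
    {α δ : ℝ} (hα : 0 < α) (hδ : 0 < δ) (hδ1 : δ < 1)
    {Ω : Type*} [MeasurableSpace Ω] (𝒜 : Algorithm n Ω) (hPAC : 𝒜.IsPAC α δ)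
    {κ : ℝ} (hακ : α ≤ κ) (hκ : 4 * κ + ((n : ℝ) - 4) * α ≤ 1)
    (hκα : 4 * κ ≠ ((n : ℝ) - 4) * α)
    {s : ℝ} (hs : s = α ∨ s = -α) :
    Admissible (hardMatrix n κ s) ∧
      ∀ ν : Pair n → ProbabilityMeasure ℝ, IsDuelModel (hardMatrix n κ s) ν →
        (ν (cornerPair n (by omega)) : Measure ℝ) = gaussianReal (-2 * κ + s) 1 →
        ENNReal.ofReal (1 / (2 * α ^ 2) * Real.log (5 / (12 * δ))) ≤ 𝒜.expectedTime ν := by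
  obtain ⟨m, rfl⟩ := hodd
  have hm : 2 ≤ m := by omega
  have hmR : (2 : ℝ) ≤ m := by exact_mod_cast hm
  push_cast at hκ hκα
  have hκ0 : 0 < κ := hα.trans_le hακ
  have hprod : α ≤ (2 * m - 3) * α := le_mul_of_one_le_left hα.le (by linarith)
  have hadm : ∀ s, s = α ∨ s = -α → Admissible (hardMatrix (2 * m + 1) κ s) := by
    intro s hs
    refine admissible_hardMatrix hm hκ0 (by linarith) ?_ ?_
    · rw [abs_le]
      rcases hs with rfl | rfl <;> constructor <;> linarith
    · rcases hs with rfl | rfl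
      · linarith
      · intro h
        exact hκα (by linarith)
  refine ⟨hadm s hs, fun ν hν hcorner => ?_⟩
  -- Only the falsity of the opposite conclusion is needed: it puts the event of a correct stop
  -- inside the event of the stated verdict.
  have hP : ∀ μ, IsDuelModel (hardMatrix (2 * m + 1) κ α) μ →
      1 - δ ≤ (𝒜.law μ).real {z | 𝒜.Concludes Verdict.nonRedundant z} := fun μ hμ =>
    (hPAC _ (hadm α (Or.inl rfl)) μ hμ).trans <| measureReal_mono fun z hz =>
      hz.elim And.left fun h =>
        absurd h.2 (not_alphaRedundant_hardMatrix hm hα hακ (by linarith))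
  have hN : ∀ μ, IsDuelModel (hardMatrix (2 * m + 1) κ (-α)) μ →
      1 - δ ≤ (𝒜.law μ).real {z | 𝒜.Concludes Verdict.redundant z} := fun μ hμ =>
    (hPAC _ (hadm (-α) (Or.inr rfl)) μ hμ).trans <| measureReal_mono fun z hz =>
      hz.elim (fun h => absurd h.2 (not_nonRedundant_hardMatrix hm hκ0.le (by linarith))) And.left
  set c := cornerPair (2 * m + 1) (by omega) with hcdef
  classical
  -- The competing model has the matrix with `-s`. All other laws are kept, as the remaining entries
  -- do not depend on `s`, so they contribute nothing to the likelihood ratio and may be arbitrary.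
  let ν' : Pair (2 * m + 1) → ProbabilityMeasure ℝ :=
    Function.update ν c ⟨gaussianReal (-2 * κ + -s) 1, inferInstance⟩
  have hne : ∀ p, p ≠ c → ν' p = ν p := fun p hp => Function.update_of_ne hp _ _
  have hc' : (ν' c : Measure ℝ) = gaussianReal (-2 * κ + -s) 1 := by
    have h : ν' c = ⟨gaussianReal (-2 * κ + -s) 1, inferInstance⟩ := Function.update_self _ _ _
    rw [h]
    rfl
  have hentry : ∀ p : Pair (2 * m + 1), p ≠ c →
      hardMatrix (2 * m + 1) κ (-s) p.1.1 p.1.2 = hardMatrix (2 * m + 1) κ s p.1.1 p.1.2 := by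
    intro p hp
    have hpc : ¬ ((p.1.1 : ℕ) = 0 ∧ (p.1.2 : ℕ) = 2 * m + 1 - 1) := fun h =>
      hp (Subtype.ext (Prod.ext (Fin.ext h.1) (Fin.ext h.2)))
    simp only [hardMatrix, if_pos p.2, hardEntry, if_neg hpc]
  have hν' : IsDuelModel (hardMatrix (2 * m + 1) κ (-s)) ν' := by
    intro p
    by_cases hp : p = c
    · rw [hp, hc']
      have : hardMatrix (2 * m + 1) κ (-s) c.1.1 c.1.2 = -2 * κ + -s := by
        rw [hardMatrix, if_pos c.2]
        exact if_pos ⟨rfl, rfl⟩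
      rw [this]
      exact isSubGaussian_gaussianReal _
    · rw [hne p hp, hentry p hp]
      exact hν p
  have hs0 : s ≠ 0 := by rcases hs with rfl | rfl <;> simp [hα.ne']
  have hs2 : s ^ 2 = α ^ 2 := by rcases hs with rfl | rfl <;> ring
  have hrate : 1 / (2 * α ^ 2) = 2 / ((-2 * κ + s) - (-2 * κ + -s)) ^ 2 := by
    rw [← hs2, div_eq_div_iff (by positivity) (by ring_nf; positivity)]
    ring
  have hxy : -2 * κ + s ≠ -2 * κ + -s := fun h => hs0 (by linarith)
  rw [hrate]
  rcases hs with rfl | rfl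
  · exact 𝒜.ofReal_le_expectedTime_of_gaussian hne hxy hcorner hc'
      (v := Verdict.nonRedundant) (w := Verdict.redundant) (by simp) (by simp) hδ (hP ν hν)
      (by simp) (hN ν' hν')
  · rw [neg_neg] at hν'
    exact 𝒜.ofReal_le_expectedTime_of_gaussian hne hxy hcorner hc'
      (v := Verdict.redundant) (w := Verdict.nonRedundant) (by simp) (by simp) hδ (hN ν hν)
      (by simp) (hP ν' hν')
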